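/- Let $n\ge 2$ and let $B_1\subset\mathbb R^n$ be the open unit ball. Let $f\in C^2([0,\infty);[0,\infty))$ satisfy $f'>0$ on $(0,\infty)$, let $\lambda\ge 0$, and let $(\alpha,\psi)$, with $\alpha>0$ and $\psi\in C^2(\overline{B_1})$, solve $$-\Delta\psi=f(\alpha+\lambda\psi)\ \text{in }B_1,\qquad \int_{B_1}f(\alpha+\lambda\psi)\,dx=1,\qquad \psi>0\ \text{in }B_1,\qquad \psi=0\ \text{on }\partial B_1 .$$ Put $V=f'(\alpha+\lambda\psi)$, $\langle u\rangle=\int_{B_1}Vu\,dx\big/\int_{B_1}V\,dx$ and $[u]=u-\langle u\rangle$. A function $\varphi\in H^1_0(B_1)\setminus\{0\}$ is an eigenfunction of $L_\lambda=-\Delta-\lambda V[\,\cdot\,]$ with eigenvalue $\sigma$ if it is a weak solution of $-\Delta\varphi-\lambda V[\varphi]=\sigma V[\varphi]$ in $B_1$. For $X\subseteq H^1_0(B_1)$, the $k$-th eigenvalue in $X$ ($k\ge1$, counted with multiplicity) is defined inductively by $$\sigma_k=\min\left\{\frac{\int_{B_1}|\nabla\eta|^2-\lambda\int_{B_1}V[\eta]^2}{\int_{B_1}V[\eta]^2}\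 :\ \eta\in X\setminus\{0\},\ \int_{B_1}V[\eta][\varphi_j]=0\ \text{ for } 1\le j\le k-1\right\},$$ where $\varphi_j$ is a minimizer for $\sigma_j$. Let $\sigma_k$ be the $k$-th eigenvalue either in the class $X$ of radial functions (only radial eigenfunctions are enumerated) or in $X=H^1_0(B_1)$ (all eigenfunctions are enumerated). Let $\varphi$ be a radial eigenfunction with eigenvalue $\sigma_k$, with the sign chosen so that $\langle\varphi\rangle\ge0$ (replace $\varphi$ by $-\varphi$ if necessary). Then $\varphi(x)=g(|x|)$ for a function $g\in C^2([0,1])$ (after modification on a null set), and $\varphi$ has at most $2k$ generalized nodal domains. Here a singular point of $\varphi$ is an $r_0\in[0,1]$ with $g(r_0)=g'(r_0)=0$ and $g''(r_0)>0$ (one-sided derivatives at $0$ and $1$). A generalized nodal domain is a nonempty, connected, open, radially symmetric set $\Omega_0\subseteq B_1$ such that: (i) $\varphi=0$ on $\partial\Omega_0$, and $g'(|x|)\ne0$ for every $x\in\partial\Omega_0$ with $|x|<1$; (ii) $\varphi\ge0$ in $\Omega_0$ or $\varphi\le0$ in $\Omega_0$; (iii) if $\varphi\le0$ in $\Omega_0$,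 then $\varphi<0$ in $\Omega_0$; (iv) if $\varphi\ge0$ in $\Omega_0$, then $\varphi>0$ in $\Omega_0$ except possibly on finitely many spheres $\{|x|=r_i\}$ with each $r_i$ a singular point of $\varphi$. -/

import Mathlib

open MeasureTheory Set Metric
open scoped ContDiff ENNReal InnerProductSpace Distributions Gradient

noncomputable section

namespace MeanField

/-- `ℝⁿ` with its Euclidean norm. -/
abbrev E (n : ℕ) : Type := EuclideanSpace ℝ (Fin n)

/-- The open unit ball `B₁` of `ℝⁿ`, as an open set. -/
def unitBall (n : ℕ) : TopologicalSpace.Opens (E n) := ⟨ball 0 1, isOpen_ball⟩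

/-- Lebesgue measure on the unit ball. -/
abbrev ballMeasure (n : ℕ) : Measure (E n) := volume.restrict (ball (0 : E n) 1)

/-- `(α, ψ)` solves the mean field type problem on the unit ball:
`-Δψ = f(α + λψ)` and `ψ > 0` in `B₁`, `∫ f(α + λψ) = 1`, `α > 0`, `ψ = 0` on `∂B₁`,
with `ψ` of class `C²` up to the boundary. -/
structure IsSolution {n : ℕ} (f : ℝ → ℝ) (lam α : ℝ) (ψ : E n → ℝ) : Prop where
  contDiffOn : ContDiffOn ℝ 2 ψ (closedBall 0 1)
  equation : ∀ x ∈ ball (0 : E n) 1, -(Laplacian.laplacian ψ x) = f (α + lam * ψ x)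
  mass : ∫ x in ball (0 : E n) 1, f (α + lam * ψ x) = 1
  alpha_pos : 0 < α
  pos : ∀ x ∈ ball (0 : E n) 1, 0 < ψ x
  boundary : ∀ x ∈ sphere (0 : E n) 1, ψ x = 0

/-- The weight `V_λ = f'(α + λψ)`. -/
def weight {n : ℕ} (f : ℝ → ℝ) (lam α : ℝ) (ψ : E n → ℝ) : E n → ℝ :=
  fun x => deriv f (α + lam * ψ x)

/-- The pairs `(η, ∇η)` in `L²(B₁) × L²(B₁; ℝⁿ)`, for `η` a smooth function with compact support
in the open ball. -/
def testPairs (n : ℕ) : Set (Lp ℝ 2 (ballMeasure n) × Lp (E n) 2 (ballMeasure n)) :=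
  {p | ∃ η : 𝓓(unitBall n, ℝ),
    p.1 =ᵐ[ballMeasure n] (η : E n → ℝ) ∧ p.2 =ᵐ[ballMeasure n] ∇ (η : E n → ℝ)}

/-- `H¹₀(B₁)`: the closure of the test functions in the `H¹` norm. An element is stored together
with its weak gradient, as the pair `(φ, ∇φ)`. -/
def H10 (n : ℕ) : Submodule ℝ (Lp ℝ 2 (ballMeasure n) × Lp (E n) 2 (ballMeasure n)) :=
  (Submodule.span ℝ (testPairs n)).topologicalClosure

/-- The function underlying an element of `H¹₀(B₁)`. -/
def fn {n : ℕ} (φ : H10 n) : E n → ℝ := φ.1.1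

/-- The weak gradient of an element of `H¹₀(B₁)`. -/
def grad {n : ℕ} (φ : H10 n) : E n → E n := φ.1.2

/-- The weighted average `⟨u⟩ = ∫ V u / ∫ V`. -/
def avg {n : ℕ} (V u : E n → ℝ) : ℝ :=
  (∫ x in ball (0 : E n) 1, V x * u x) / ∫ x in ball (0 : E n) 1, V x

/-- The oscillation `[u] = u - ⟨u⟩`. -/
def osc {n : ℕ} (V u : E n → ℝ) : E n → ℝ := fun x => u x - avg V u

/-- `∫ V [u] [v]`. -/
def oscForm {n : ℕ} (V u v : E n → ℝ) : ℝ :=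
  ∫ x in ball (0 : E n) 1, V x * osc V u x * osc V v x

/-- `φ ∈ H¹₀(B₁) \ {0}` is a weak solution of `-Δφ - λ V [φ] = σ V [φ]`, i.e. an eigenfunction of
the eigenvalue `σ` of `L_λ`. -/
def IsEigenfunction {n : ℕ} (V : E n → ℝ) (lam σ : ℝ) (φ : H10 n) : Prop :=
  φ ≠ 0 ∧ ∀ η : H10 n,
    (∫ x in ball (0 : E n) 1, ⟪grad φ x, grad η x⟫_ℝ)
        - lam * (∫ x in ball (0 : E n) 1, V x * osc V (fn φ) x * fn η x)
      = σ * ∫ x in ball (0 : E n) 1, V x * osc V (fn φ) x * fn η x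

/-- The Rayleigh quotient `(∫ |∇φ|² - λ ∫ V [φ]²) / ∫ V [φ]²`. -/
def rayleigh {n : ℕ} (V : E n → ℝ) (lam : ℝ) (φ : H10 n) : ℝ :=
  ((∫ x in ball (0 : E n) 1, ‖grad φ x‖ ^ 2) - lam * oscForm V (fn φ) (fn φ))
    / oscForm V (fn φ) (fn φ)

/-- The nonzero elements of `X` with `∫ V [η] [e i] = 0` for all `1 ≤ i < j`. -/
def admissible {n : ℕ} (V : E n → ℝ) (X : Set (H10 n)) (e : ℕ → H10 n) (j : ℕ) : Set (H10 n) :=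
  {η | η ∈ X ∧ η ≠ 0 ∧ ∀ i, 1 ≤ i → i < j → oscForm V (fn η) (fn (e i)) = 0}

/-- `σ` is the `k`-th eigenvalue (`k ≥ 1`, counted with multiplicity) of `L_λ` within the class
`X ⊆ H¹₀(B₁)`: there are `e 1, …, e k` such that each `e j` minimizes the Rayleigh quotient among
the nonzero elements of `X` orthogonal to `e 1, …, e (j-1)`, and `σ` is the `k`-th minimum. -/
def IsKthEigenvalue {n : ℕ} (V : E n → ℝ) (lam : ℝ) (X : Set (H10 n)) (k : ℕ) (σ : ℝ) : Prop :=
  ∃ e : ℕ → H10 n,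
    (∀ j, 1 ≤ j → j ≤ k →
      e j ∈ admissible V X e j ∧ IsMinOn (rayleigh V lam) (admissible V X e j) (e j)) ∧
    σ = rayleigh V lam (e k)

/-- The radial elements of `H¹₀(B₁)`. -/
def radialH10 (n : ℕ) : Set (H10 n) :=
  {φ | ∃ g : ℝ → ℝ, fn φ =ᵐ[ballMeasure n] fun x => g ‖x‖}

/-- The derivative of a radial profile on `[0,1]`, one-sided at the end points. -/
def profileDeriv (g : ℝ → ℝ) : ℝ → ℝ := derivWithin g (Icc 0 1)

/-- A singular point of the radial profile `g`: a point `r ∈ [0,1]` with `g(r) = 0`, `g'(r) = 0`,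
`g''(r) > 0`. -/
def IsSingularPoint (g : ℝ → ℝ) (r : ℝ) : Prop :=
  r ∈ Icc (0 : ℝ) 1 ∧ g r = 0 ∧ profileDeriv g r = 0 ∧ 0 < profileDeriv (profileDeriv g) r

/-- `Ω₀ ⊆ B₁` is a generalized nodal domain of the radial function `x ↦ g ‖x‖`. -/
structure IsGeneralizedNodalDomain {n : ℕ} (g : ℝ → ℝ) (Ω₀ : Set (E n)) : Prop where
  subset_ball : Ω₀ ⊆ ball 0 1
  isOpen : IsOpen Ω₀
  isConnected : IsConnected Ω₀
  radial : ∀ x y : E n, ‖x‖ = ‖y‖ → x ∈ Ω₀ → y ∈ Ω₀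
  frontier_zero : ∀ x ∈ frontier Ω₀, g ‖x‖ = 0
  frontier_regular : ∀ x ∈ frontier Ω₀, ‖x‖ < 1 → profileDeriv g ‖x‖ ≠ 0
  sign : (∀ x ∈ Ω₀, 0 ≤ g ‖x‖) ∨ (∀ x ∈ Ω₀, g ‖x‖ ≤ 0)
  neg : (∀ x ∈ Ω₀, g ‖x‖ ≤ 0) → ∀ x ∈ Ω₀, g ‖x‖ < 0
  nonneg : (∀ x ∈ Ω₀, 0 ≤ g ‖x‖) → ∃ S : Finset ℝ, (∀ r ∈ S, IsSingularPoint g r) ∧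
    ∀ x ∈ Ω₀, ‖x‖ ∉ S → 0 < g ‖x‖

end MeanField

end

open MeasureTheory Set Metric
open scoped ContDiff ENNReal InnerProductSpace Distributions Gradient

namespace MeanField

/-! Write `a = ⟨φ⟩` and `m = λ + σ`, so that `-Δφ = m V (φ - a)`. Testing with `φ` gives `m > 0`.
The radial profile `g` satisfies a linear second-order ODE with `g(1) = 0`. Since `∫ V [φ] = 0`, the
flux through the unit sphere vanishes, so also `g'(1) = 0`. If `a` were zero, these Cauchy data
would force `g = 0`; hence `a > 0`. Consequently `g'' > 0` wherever `g = g' = 0`, in particular at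
`r = 1`.

The count rests on a Courant argument that works only for nonnegative bumps (`courant`). Suppose `k
+ 1` disjoint intervals, bounded by zeros of `g` (or by the origin), carry a nonnegative nonzero
profile. Some nontrivial combination `η = ∑ tᵢ g 1_{Iᵢ}` has mean zero and is orthogonal to the
first `k - 1` minimizers. Testing the equation with `ζ = ∑ tᵢ² g 1_{Iᵢ}` gives `∫ |∇η|² = m (Q - a
P)`, where `Q = ∫ V η²` and `P = ∫ V ζ > 0`. The Rayleigh quotient of `η` is then `σ - m a P / Q <
σ`, contradicting minimality. The gain `m a P` makes the inequality strict, so no unique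
continuation is needed. As `η` is radial, it competes in both classes of functions.

So there are at most `k` nonnegative domains (`encard_nonneg_le`). On a negative domain the sign of
`P` would be wrong. Instead, the outer radius of such a domain is less than `1`, because `g > 0`
just inside the unit sphere, and `g` crosses zero there with positive slope. Each negative domain is
therefore followed by a positive bump (`exists_positive_follower`). Distinct domains have disjoint
followers, and Courant applies to these (`encard_nonpos_le`).

The analytic work is to obtain the `C²` profile (`exists_profile`). The weight need not be known to
be radial: against radial test functions it acts through its spherical mean. An explicit radial
solution is matched with `φ` by uniqueness in `H¹₀`, and a bootstrap removes the possible
singularity at the origin. -/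

/-! ### Polar coordinates on the ball. -/

/-- The measure `r ^ (n - 1) dr` on `(0, 1)`. -/
noncomputable def radMeasure (n : ℕ) : Measure ℝ :=
  (volume.restrict (Ioo (0 : ℝ) 1)).withDensity fun r => ENNReal.ofReal (r ^ (n - 1))

/-- The surface measure on the unit sphere. -/
noncomputable abbrev sphereMeasure (n : ℕ) : Measure (sphere (0 : E n) 1) :=
  (volume : Measure (E n)).toSphere

/-- Polar coordinates. -/
def polar {n : ℕ} (p : sphere (0 : E n) 1 × ℝ) : E n := p.2 • (p.1 : E n)

lemma continuous_polar {n : ℕ} : Continuous (polar (n := n)) := by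
  unfold polar; fun_prop

lemma norm_polar {n : ℕ} (p : sphere (0 : E n) 1 × ℝ) : ‖polar p‖ = |p.2| := by
  simp [polar, norm_smul]

lemma measurePreserving_polar_aux {n : ℕ} (hn : 1 ≤ n) :
    MeasurePreserving (polar (n := n))
      ((sphereMeasure n).prod ((volume.restrict (Ioi (0 : ℝ))).withDensity
        fun r => ENNReal.ofReal (r ^ (n - 1)))) volume := by
  have : Nonempty (Fin n) := ⟨⟨0, hn⟩⟩
  have hdim : Module.finrank ℝ (E n) = n := by simp
  have h1 := (Measure.measurePreserving_homeomorphUnitSphereProd (volume : Measure (E n)))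
  rw [hdim] at h1
  have h2 := MeasurePreserving.symm (homeomorphUnitSphereProd (E n)).toMeasurableEquiv h1
  have h3 : MeasurePreserving (Subtype.val : ({0}ᶜ : Set (E n)) → E n)
      ((volume : Measure (E n)).comap (↑)) volume := by
    refine ⟨measurable_subtype_coe, ?_⟩
    rw [map_comap_subtype_coe (measurableSet_singleton _).compl,
      restrict_compl_singleton]
  have h4 : MeasurePreserving (Subtype.val : Ioi (0 : ℝ) → ℝ) (Measure.volumeIoiPow (n - 1))
      ((volume.restrict (Ioi (0 : ℝ))).withDensity
        fun r => ENNReal.ofReal (r ^ (n - 1))) := by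
    refine ⟨measurable_subtype_coe, ?_⟩
    ext s hs
    rw [Measure.map_apply measurable_subtype_coe hs, Measure.volumeIoiPow,
      withDensity_apply _ (measurable_subtype_coe hs), withDensity_apply _ hs,
      Measure.restrict_restrict hs]
    rw [setLIntegral_subtype measurableSet_Ioi _ fun a : ℝ ↦ ENNReal.ofReal (a ^ (n - 1))]
    rw [Subtype.image_preimage_coe, inter_comm]
  have : SFinite ((volume.restrict (Ioi (0 : ℝ))).withDensity
        fun r => ENNReal.ofReal (r ^ (n - 1))) := by infer_instance
  have h5 := (MeasurePreserving.id (sphereMeasure n)).prod h4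
  have h6 := h3.comp h2
  refine ⟨continuous_polar.measurable, ?_⟩
  rw [← h5.map_eq, Measure.map_map continuous_polar.measurable h5.measurable, ← h6.map_eq]
  rfl

theorem measurePreserving_polar {n : ℕ} (hn : 1 ≤ n) :
    MeasurePreserving (polar (n := n)) ((sphereMeasure n).prod (radMeasure n))
      (ballMeasure n) := by
  have h := (measurePreserving_polar_aux hn).restrict_preimage
    (measurableSet_ball (x := (0 : E n)) (ε := 1))
  have hpre : polar ⁻¹' (ball (0 : E n) 1) = univ ×ˢ Ioo (-1 : ℝ) 1 := by
    ext p
    simp [norm_polar, abs_lt]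
  rw [hpre, ← Measure.prod_restrict, Measure.restrict_univ,
    restrict_withDensity measurableSet_Ioo, Measure.restrict_restrict measurableSet_Ioo] at h
  have : Ioo (-1 : ℝ) 1 ∩ Ioi 0 = Ioo 0 1 := by
    ext x; simp only [mem_inter_iff, mem_Ioo, mem_Ioi]; constructor
    · rintro ⟨⟨_, h⟩, h'⟩; exact ⟨h', h⟩
    · rintro ⟨h, h'⟩; exact ⟨⟨by linarith, h'⟩, h⟩
  rw [this] at h
  exact h

lemma ae_radMeasure_iff {n : ℕ} {p : ℝ → Prop} :
    (∀ᵐ r ∂radMeasure n, p r) ↔ ∀ᵐ r ∂(volume.restrict (Ioo (0 : ℝ) 1)), p r := by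
  rw [radMeasure, ae_withDensity_iff (by fun_prop)]
  constructor <;> intro h
  · filter_upwards [h, ae_restrict_mem measurableSet_Ioo] with r hr h0
    exact hr (by simpa using pow_pos h0.1 _)
  · filter_upwards [h] with r hr _ using hr

lemma radMeasure_le (n : ℕ) : radMeasure n ≤ volume.restrict (Ioo (0 : ℝ) 1) := by
  conv_rhs => rw [← withDensity_one (μ := volume.restrict (Ioo (0 : ℝ) 1))]
  refine withDensity_mono ?_
  filter_upwards [ae_restrict_mem measurableSet_Ioo] with r hr
  simpa using pow_le_one₀ hr.1.le hr.2.le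

instance (n : ℕ) : IsFiniteMeasure (radMeasure n) :=
  ⟨(radMeasure_le n univ).trans_lt (by simp)⟩

lemma ae_radMeasure_mem (n : ℕ) : ∀ᵐ r ∂radMeasure n, r ∈ Ioo (0 : ℝ) 1 :=
  ae_radMeasure_iff.2 (ae_restrict_mem measurableSet_Ioo)

lemma integral_radMeasure (n : ℕ) (h : ℝ → ℝ) :
    ∫ r, h r ∂radMeasure n = ∫ r in Ioo (0 : ℝ) 1, r ^ (n - 1) * h r := by
  rw [radMeasure, integral_withDensity_eq_integral_toReal_smul (by fun_prop) (by simp)]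
  refine setIntegral_congr_fun measurableSet_Ioo fun r hr => ?_
  simp [ENNReal.toReal_ofReal (pow_nonneg hr.1.le (n - 1))]

lemma integrable_radMeasure_iff {n : ℕ} {h : ℝ → ℝ} :
    Integrable h (radMeasure n) ↔ IntegrableOn (fun r => r ^ (n - 1) * h r) (Ioo (0 : ℝ) 1) := by
  rw [radMeasure, integrable_withDensity_iff_integrable_smul' (by fun_prop) (by simp)]
  refine integrable_congr ?_
  filter_upwards [ae_restrict_mem measurableSet_Ioo] with r hr
  simp [ENNReal.toReal_ofReal (pow_nonneg hr.1.le (n - 1))]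

/-- The area of the unit sphere. -/
noncomputable def area (n : ℕ) : ℝ≥0∞ := sphereMeasure n univ

lemma area_ne_top (n : ℕ) : area n ≠ ⊤ := measure_ne_top _ _

lemma area_ne_zero {n : ℕ} (hn : 1 ≤ n) : area n ≠ 0 := by
  have : Nonempty (Fin n) := ⟨⟨0, hn⟩⟩
  rw [area, Ne, Measure.measure_univ_eq_zero]
  exact Measure.toSphere_ne_zero _

theorem map_norm_ballMeasure {n : ℕ} (hn : 1 ≤ n) :
    (ballMeasure n).map norm = area n • radMeasure n := by
  have h := (measurePreserving_polar hn).map_eq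
  rw [← h, Measure.map_map measurable_norm continuous_polar.measurable]
  have : (norm ∘ polar : sphere (0 : E n) 1 × ℝ → ℝ) =ᵐ[(sphereMeasure n).prod (radMeasure n)]
      Prod.snd := by
    have := Measure.quasiMeasurePreserving_snd (μ := sphereMeasure n) (ν := radMeasure n)
    filter_upwards [this.ae (ae_radMeasure_mem n)] with p hp
    simp [norm_polar, abs_of_pos hp.1]
  rw [Measure.map_congr this, Measure.map_snd_prod]
  rfl

/-- A property of the radius that holds almost everywhere. -/
lemma ae_norm_iff {n : ℕ} (hn : 1 ≤ n) {p : ℝ → Prop} :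
    (∀ᵐ r ∂radMeasure n, p r) → ∀ᵐ x ∂ballMeasure n, p ‖x‖ := by
  intro h
  refine ae_of_ae_map measurable_norm.aemeasurable ?_
  rw [map_norm_ballMeasure hn]
  exact Measure.ae_smul_measure h _

/-- Returns from the ball to the radius. Measurable representatives make the set of equality
measurable, so that the push-forward under the norm detects it. -/
lemma ae_of_ae_norm {n : ℕ} (hn : 1 ≤ n) {g h : ℝ → ℝ} (hg : AEStronglyMeasurable g (radMeasure n))
    (hh : AEStronglyMeasurable h (radMeasure n))
    (H : ∀ᵐ x ∂ballMeasure n, g ‖x‖ = h ‖x‖) : g =ᵐ[radMeasure n] h := by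
  have h1 : ∀ᵐ x ∂ballMeasure n, hg.mk g ‖x‖ = hh.mk h ‖x‖ := by
    filter_upwards [H, ae_norm_iff hn hg.ae_eq_mk, ae_norm_iff hn hh.ae_eq_mk] with x h1 h2 h3
    rw [← h2, ← h3, h1]
  have h2 : ∀ᵐ r ∂((ballMeasure n).map norm), hg.mk g r = hh.mk h r := by
    rw [ae_map_iff measurable_norm.aemeasurable]
    · exact h1
    · exact (measurableSet_eq_fun hg.stronglyMeasurable_mk.measurable
        hh.stronglyMeasurable_mk.measurable)
  rw [map_norm_ballMeasure hn, Measure.ae_ennreal_smul_measure_iff (area_ne_zero hn)] at h2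
  filter_upwards [h2, hg.ae_eq_mk, hh.ae_eq_mk] with r h3 h4 h5
  rw [h4, h5, h3]

/-! ### Test functions, `H¹₀` and the Poincaré inequality. -/

lemma contDiff_test {n : ℕ} (η : 𝓓(unitBall n, ℝ)) : ContDiff ℝ ∞ (η : E n → ℝ) := by
  simpa using η.contDiff

lemma differentiable_test {n : ℕ} (η : 𝓓(unitBall n, ℝ)) : Differentiable ℝ (η : E n → ℝ) :=
  (contDiff_test η).differentiable (by simp)

lemma continuous_gradient_test {n : ℕ} (η : 𝓓(unitBall n, ℝ)) : Continuous (∇ (η : E n → ℝ)) := by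
  have : Continuous (fderiv ℝ (η : E n → ℝ)) := (contDiff_test η).continuous_fderiv (by simp)
  exact (InnerProductSpace.toDual ℝ (E n)).symm.continuous.comp this

lemma norm_gradient_eq {n : ℕ} (u : E n → ℝ) (x : E n) : ‖∇ u x‖ = ‖fderiv ℝ u x‖ := by
  simp [gradient]

lemma test_eq_zero {n : ℕ} (η : 𝓓(unitBall n, ℝ)) {x : E n} (hx : x ∉ ball (0 : E n) 1) :
    η x = 0 :=
  image_eq_zero_of_notMem_tsupport fun h => hx (η.tsupport_subset h)

lemma memLp_ball_of_continuous {n : ℕ} {F : Type*} [NormedAddCommGroup F] [MeasurableSpace F]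
    [BorelSpace F] [SecondCountableTopology F]
    {u : E n → F} (hu : ContinuousOn u (closedBall 0 1)) (p : ℝ≥0∞) :
    MemLp u p (ballMeasure n) := by
  obtain ⟨C, hC⟩ := (isCompact_closedBall (0 : E n) 1).exists_bound_of_continuousOn hu
  have hfin : IsFiniteMeasure (ballMeasure n) := ⟨by simp [measure_ball_lt_top]⟩
  refine MemLp.of_bound
    ((hu.mono ball_subset_closedBall).aestronglyMeasurable measurableSet_ball) C ?_
  filter_upwards [ae_restrict_mem measurableSet_ball] with x hx
  exact hC x (ball_subset_closedBall hx)

instance (n : ℕ) : IsFiniteMeasure (ballMeasure n) := ⟨by simp [measure_ball_lt_top]⟩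

lemma mem_testPairs_of_test {n : ℕ} (η : 𝓓(unitBall n, ℝ)) :
    ((memLp_ball_of_continuous η.continuous.continuousOn 2).toLp (η : E n → ℝ),
      (memLp_ball_of_continuous (continuous_gradient_test η).continuousOn 2).toLp
        (∇ (η : E n → ℝ))) ∈ testPairs n :=
  ⟨η, (memLp_ball_of_continuous η.continuous.continuousOn 2).coeFn_toLp,
    (memLp_ball_of_continuous (continuous_gradient_test η).continuousOn 2).coeFn_toLp⟩

lemma gradient_add' {n : ℕ} {u v : E n → ℝ} {x : E n} (hu : DifferentiableAt ℝ u x)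
    (hv : DifferentiableAt ℝ v x) : ∇ (u + v) x = ∇ u x + ∇ v x := by
  simp [gradient, fderiv_add hu hv]

lemma gradient_smul' {n : ℕ} {u : E n → ℝ} {x : E n} (c : ℝ) (hu : DifferentiableAt ℝ u x) :
    ∇ (c • u) x = c • ∇ u x := by
  simp [gradient, fderiv_const_smul hu]

/-- Test functions are closed under linear combinations, and so are their gradients. Hence `H10` is
the closure of `testPairs` itself, and a closed condition only has to be checked on test functions.
-/
lemma span_testPairs (n : ℕ) : (Submodule.span ℝ (testPairs n) : Set _) = testPairs n := by
  refine Subset.antisymm (fun p hp => ?_) Submodule.subset_span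
  refine Submodule.span_induction (fun _ h => h) ?_ ?_ ?_ hp
  · refine ⟨0, ?_, ?_⟩
    · filter_upwards [Lp.coeFn_zero ℝ 2 (ballMeasure n)] with x hx using by simpa using hx
    · filter_upwards [Lp.coeFn_zero (E n) 2 (ballMeasure n)] with x hx
      simpa [gradient, FunLike.coe_zero] using hx
  · rintro p q - - ⟨η, h1, h2⟩ ⟨ζ, h3, h4⟩
    refine ⟨η + ζ, ?_, ?_⟩
    · filter_upwards [h1, h3, Lp.coeFn_add p.1 q.1] with x a b c
      refine c.trans ?_
      simp [a, b]
    · filter_upwards [h2, h4, Lp.coeFn_add p.2 q.2] with x a b c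
      have := gradient_add' (differentiable_test η x) (differentiable_test ζ x)
      refine c.trans ?_
      simpa [a, b] using this.symm
  · rintro r p - ⟨η, h1, h2⟩
    refine ⟨r • η, ?_, ?_⟩
    · filter_upwards [h1, Lp.coeFn_smul r p.1] with x a c
      refine c.trans ?_
      simp [a]
    · filter_upwards [h2, Lp.coeFn_smul r p.2] with x a c
      have := gradient_smul' r (differentiable_test η x)
      refine c.trans ?_
      simpa [a] using this.symm

lemma mem_H10_iff {n : ℕ} {p : Lp ℝ 2 (ballMeasure n) × Lp (E n) 2 (ballMeasure n)} :
    p ∈ H10 n ↔ p ∈ closure (testPairs n) := by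
  rw [H10, ← SetLike.mem_coe, Submodule.topologicalClosure_coe, span_testPairs]

/-- Closed properties pass from test functions to `H¹₀`. -/
lemma H10_of_closed {n : ℕ} {P : Lp ℝ 2 (ballMeasure n) × Lp (E n) 2 (ballMeasure n) → Prop}
    (hP : IsClosed {p | P p}) (h : ∀ p ∈ testPairs n, P p) (φ : H10 n) : P φ.1 :=
  closure_minimal h hP (mem_H10_iff.1 φ.2)

/-- The Poincaré inequality. -/
theorem exists_poincare {n : ℕ} (hn : 2 ≤ n) : ∃ C : ℝ, ∀ φ : H10 n, ‖φ.1.1‖ ≤ C * ‖φ.1.2‖ := by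
  -- This is the exponent whose Sobolev conjugate is `2`: `1/p - 1/n = 1/2`. The condition `p ≥ 1`
  -- is exactly `n ≥ 2`. Hölder on the ball then replaces the `L^p` norm of the gradient by its `L²`
  -- norm.
  let p : NNReal := 2 * n / (n + 2)
  have hp0 : (p : ℝ) = 2 * n / (n + 2) := by simp [p]
  have hn' : (2 : ℝ) ≤ n := by exact_mod_cast hn
  have hp1 : 1 ≤ p := by
    rw [← NNReal.coe_le_coe, hp0, NNReal.coe_one, le_div_iff₀ (by positivity)]; linarith
  have hp2 : p ≤ 2 := by
    rw [← NNReal.coe_le_coe, hp0, NNReal.coe_ofNat, div_le_iff₀ (by positivity)]; linarith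
  have hpn : p < Module.finrank ℝ (E n) := by
    rw [← NNReal.coe_lt_coe, hp0]
    simp only [finrank_euclideanSpace, Fintype.card_fin, NNReal.coe_natCast]
    rw [div_lt_iff₀ (by positivity)]; nlinarith
  have hpq : (p : ℝ)⁻¹ - (Module.finrank ℝ (E n) : ℝ)⁻¹ ≤ ((2 : NNReal) : ℝ)⁻¹ := by
    rw [hp0]
    simp only [finrank_euclideanSpace, Fintype.card_fin, NNReal.coe_ofNat]
    apply le_of_eq; field_simp; ring
  let C1 := eLpNormLESNormFDerivOfLeConst ℝ (volume : Measure (E n)) (ball (0 : E n) 1) p 2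
  let C2 : ℝ≥0∞ := (ballMeasure n) univ ^ (1 / (p : ℝ≥0∞).toReal - 1 / (2 : ℝ≥0∞).toReal)
  have hC2 : C2 ≠ ⊤ := by
    apply ENNReal.rpow_ne_top_of_nonneg
    · simp only [ENNReal.coe_toReal, one_div, ENNReal.toReal_ofNat]
      rw [sub_nonneg]
      exact inv_anti₀ (by exact_mod_cast (zero_lt_one.trans_le hp1)) (by exact_mod_cast hp2)
    · exact measure_ne_top _ _
  refine ⟨(C1 * C2).toReal,
    H10_of_closed (P := fun q => ‖q.1‖ ≤ (C1 * C2).toReal * ‖q.2‖) ?_ ?_⟩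
  · exact isClosed_le (by fun_prop) (by fun_prop)
  · rintro q ⟨η, h1, h2⟩
    rw [Lp.norm_def, Lp.norm_def, ← ENNReal.toReal_mul]
    refine ENNReal.toReal_mono (ENNReal.mul_ne_top (ENNReal.mul_ne_top (by simp) hC2)
      (Lp.eLpNorm_ne_top _)) ?_
    rw [eLpNorm_congr_ae h1, eLpNorm_congr_ae h2]
    have hsupp : Function.support (fderiv ℝ (η : E n → ℝ)) ⊆ ball (0 : E n) 1 :=
      (support_fderiv_subset ℝ).trans η.tsupport_subset
    have hsupp' : Function.support (∇ (η : E n → ℝ)) ⊆ ball (0 : E n) 1 := by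
      intro x hx
      refine hsupp fun h => hx ?_
      rw [← norm_eq_zero, norm_gradient_eq, h, norm_zero]
    have hnorm : eLpNorm (∇ (η : E n → ℝ)) p volume
        = eLpNorm (fderiv ℝ (η : E n → ℝ)) p volume :=
      eLpNorm_congr_norm_ae (.of_forall fun x => norm_gradient_eq _ _)
    calc eLpNorm η 2 (ballMeasure n) ≤ eLpNorm η 2 volume := eLpNorm_mono_measure _ Measure.restrict_le_self
      _ ≤ C1 * eLpNorm (fderiv ℝ (η : E n → ℝ)) p volume :=
        eLpNorm_le_eLpNorm_fderiv_of_le (q := 2) volume ((contDiff_test η).of_le (by simp))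
          ((subset_tsupport _).trans η.tsupport_subset) hp1 hpn hpq isBounded_ball
      _ = C1 * eLpNorm (∇ (η : E n → ℝ)) p (ballMeasure n) := by
        rw [ballMeasure, eLpNorm_restrict_eq_of_support_subset hsupp', hnorm]
      _ ≤ C1 * (eLpNorm (∇ (η : E n → ℝ)) 2 (ballMeasure n) * C2) := by
        gcongr
        exact eLpNorm_le_eLpNorm_mul_rpow_measure_univ (by exact_mod_cast hp2)
          (continuous_gradient_test η).aestronglyMeasurable
      _ = _ := by ring

lemma eq_zero_of_grad {n : ℕ} (hn : 2 ≤ n) {φ : H10 n} (h : grad φ =ᵐ[ballMeasure n] 0) :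
    φ = 0 := by
  obtain ⟨C, hC⟩ := exists_poincare hn
  have h2 : φ.1.2 = 0 := (Lp.eq_zero_iff_ae_eq_zero).2 h
  have h1 : φ.1.1 = 0 := by simpa [h2] using hC φ
  exact Subtype.ext (Prod.ext h1 h2)

lemma memLp_fn {n : ℕ} (φ : H10 n) : MemLp (fn φ) 2 (ballMeasure n) := Lp.memLp _
lemma memLp_grad {n : ℕ} (φ : H10 n) : MemLp (grad φ) 2 (ballMeasure n) := Lp.memLp _

lemma H10_ext {n : ℕ} {φ ψ : H10 n} (h1 : fn φ =ᵐ[ballMeasure n] fn ψ)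
    (h2 : grad φ =ᵐ[ballMeasure n] grad ψ) : φ = ψ :=
  Subtype.ext (Prod.ext (Lp.ext h1) (Lp.ext h2))

lemma fn_sub {n : ℕ} (φ ψ : H10 n) : fn (φ - ψ) =ᵐ[ballMeasure n] fun x => fn φ x - fn ψ x :=
  Lp.coeFn_sub φ.1.1 ψ.1.1

lemma grad_sub {n : ℕ} (φ ψ : H10 n) :
    grad (φ - ψ) =ᵐ[ballMeasure n] fun x => grad φ x - grad ψ x :=
  Lp.coeFn_sub φ.1.2 ψ.1.2

/-- An identity `∫ ⟨X, ∇η⟩ = ∫ F η` extends from test functions to `H¹₀`. -/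
theorem weak_of_test {n : ℕ} {X : E n → E n} {F : E n → ℝ} (hX : MemLp X 2 (ballMeasure n))
    (hF : MemLp F 2 (ballMeasure n))
    (h : ∀ η : 𝓓(unitBall n, ℝ), ∫ x in ball (0 : E n) 1, ⟪X x, ∇ (η : E n → ℝ) x⟫_ℝ
      = ∫ x in ball (0 : E n) 1, F x * η x) (φ : H10 n) :
    ∫ x in ball (0 : E n) 1, ⟪X x, grad φ x⟫_ℝ = ∫ x in ball (0 : E n) 1, F x * fn φ x := by
  have e1 : ∀ q : Lp (E n) 2 (ballMeasure n),
      ⟪hX.toLp X, q⟫_ℝ = ∫ x in ball (0 : E n) 1, ⟪X x, q x⟫_ℝ := by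
    intro q
    rw [L2.inner_def]
    refine integral_congr_ae ?_
    filter_upwards [hX.coeFn_toLp] with x hx
    rw [hx]
  have e2 : ∀ q : Lp ℝ 2 (ballMeasure n),
      ⟪hF.toLp F, q⟫_ℝ = ∫ x in ball (0 : E n) 1, F x * q x := by
    intro q
    rw [L2.inner_def]
    refine integral_congr_ae ?_
    filter_upwards [hF.coeFn_toLp] with x hx
    rw [hx]
    simp [mul_comm]
  have := H10_of_closed (P := fun p => ⟪hX.toLp X, p.2⟫_ℝ = ⟪hF.toLp F, p.1⟫_ℝ)
    (isClosed_eq (by fun_prop) (by fun_prop)) ?_ φ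
  · rw [e1, e2] at this
    exact this
  · rintro p ⟨η, h1, h2⟩
    rw [e1, e2]
    rw [integral_congr_ae (g := fun x => ⟪X x, ∇ (η : E n → ℝ) x⟫_ℝ), h η]
    · refine integral_congr_ae ?_
      filter_upwards [h1] with x hx
      rw [hx]
    · filter_upwards [h2] with x hx
      rw [hx]

/-! ### Radial elements of `H¹₀` with prescribed radial derivative. -/

/-- The primitive of `k` vanishing at `1`. -/
noncomputable def prim (k : ℝ → ℝ) (r : ℝ) : ℝ := -∫ s in r..1, k s

lemma hasDerivAt_prim {k : ℝ → ℝ} (hk : Continuous k) (r : ℝ) : HasDerivAt (prim k) (k r) r := by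
  have := (intervalIntegral.integral_hasDerivAt_left (hk.intervalIntegrable r 1)
    hk.stronglyMeasurable.stronglyMeasurableAtFilter hk.continuousAt).neg
  rw [neg_neg] at this
  exact this

lemma contDiff_prim {k : ℝ → ℝ} (hk : ContDiff ℝ ∞ k) : ContDiff ℝ ∞ (prim k) := by
  have h := hasDerivAt_prim hk.continuous
  rw [contDiff_infty_iff_deriv]
  refine ⟨fun r => (h r).differentiableAt, ?_⟩
  rwa [show deriv (prim k) = k from funext fun r => (h r).deriv]

lemma hasFDerivAt_norm {n : ℕ} {x : E n} (hx : x ≠ 0) :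
    HasFDerivAt (fun y : E n => ‖y‖) (‖x‖⁻¹ • innerSL ℝ x) x := by
  have h := (hasStrictFDerivAt_norm_sq x).hasFDerivAt.sqrt (by simpa using hx)
  simp only [Real.sqrt_sq (norm_nonneg _)] at h
  convert! h using 1
  ext y
  simp
  ring

lemma gradient_radial {n : ℕ} {h : ℝ → ℝ} {h' : ℝ} {x : E n} (hx : x ≠ 0)
    (hh : HasDerivAt h h' ‖x‖) : ∇ (fun y : E n => h ‖y‖) x = (h' / ‖x‖) • x := by
  have h1 : HasFDerivAt (fun y : E n => h ‖y‖) (h' • ‖x‖⁻¹ • innerSL ℝ x) x :=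
    hh.comp_hasFDerivAt x (hasFDerivAt_norm hx)
  apply HasGradientAt.gradient
  rw [hasGradientAt_iff_hasFDerivAt]
  convert! h1 using 1
  ext y
  simp
  ring

lemma exists_margin {k : ℝ → ℝ} (hc : HasCompactSupport k) (hs : tsupport k ⊆ Ioo (0 : ℝ) 1) :
    ∃ δ : ℝ, 0 < δ ∧ ∀ r, k r ≠ 0 → δ ≤ r ∧ r ≤ 1 - δ := by
  obtain ⟨δ, hδ, h⟩ := IsCompact.exists_thickening_subset_open hc isOpen_Ioo hs
  refine ⟨δ / 2, by positivity, fun r hr => ?_⟩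
  have hr' : r ∈ tsupport k := subset_tsupport _ hr
  have h1 := h (mem_thickening_iff.2 ⟨r, hr', show dist (r - δ / 2) r < δ by
    rw [Real.dist_eq, abs_lt]; constructor <;> linarith⟩)
  have h2 := h (mem_thickening_iff.2 ⟨r, hr', show dist (r + δ / 2) r < δ by
    rw [Real.dist_eq, abs_lt]; constructor <;> linarith⟩)
  constructor <;> linarith [h1.1, h2.2]

/-- The test function with radial derivative `k`. -/
theorem exists_test_prim {n : ℕ} {k : ℝ → ℝ} (hk : ContDiff ℝ ∞ k) (hc : HasCompactSupport k)
    (hs : tsupport k ⊆ Ioo (0 : ℝ) 1) :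
    ∃ η : 𝓓(unitBall n, ℝ), (∀ x, η x = prim k ‖x‖) ∧
      ∀ x ≠ 0, ∇ (η : E n → ℝ) x = (k ‖x‖ / ‖x‖) • x := by
  obtain ⟨δ, hδ, hkδ⟩ := exists_margin hc hs
  have hp := contDiff_prim hk
  -- Constancy near the origin is what makes `x ↦ prim k ‖x‖` smooth at `0`, where the norm is not
  -- differentiable.
  have hconst : ∀ r < δ, prim k r = prim k 0 := by
    intro r hr
    have : ∫ s in r..0, k s = 0 := by
      refine intervalIntegral.integral_zero_ae (.of_forall fun s hs' => ?_)
      by_contra hne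
      have h1 := (hkδ s hne).1
      rcases le_total r 0 with h | h
      · rw [uIoc_of_le h] at hs'; linarith [hs'.2]
      · rw [uIoc_of_ge h] at hs'; linarith [hs'.2]
    simp only [prim]
    rw [← intervalIntegral.integral_add_adjacent_intervals (b := 0)
      (hk.continuous.intervalIntegrable _ _) (hk.continuous.intervalIntegrable _ _), this, zero_add]
  have hzero : ∀ r, 1 - δ < r → prim k r = 0 := by
    intro r hr
    simp only [prim, neg_eq_zero]
    refine intervalIntegral.integral_zero_ae (.of_forall fun s hs' => ?_)
    by_contra hne
    have h1 := (hkδ s hne).2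
    rcases le_total r 1 with h | h
    · rw [uIoc_of_le h] at hs'; linarith [hs'.1]
    · rw [uIoc_of_ge h] at hs'; linarith [hs'.1]
  have hsupp : tsupport (fun x : E n => prim k ‖x‖) ⊆ closedBall 0 (1 - δ) := by
    refine closure_minimal (fun x hx => ?_) isClosed_closedBall
    by_contra hx'
    exact hx (hzero _ (by simpa using hx'))
  refine ⟨⟨fun x => prim k ‖x‖, ?_, ?_, ?_⟩, fun x => rfl, fun x hx => ?_⟩
  · rw [contDiff_iff_contDiffAt]
    intro x
    by_cases hx : x = 0
    · refine contDiffAt_const (c := prim k 0) |>.congr_of_eventuallyEq ?_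
      have : ∀ᶠ y : E n in nhds x, ‖y‖ < δ := by
        subst hx
        exact continuous_norm.continuousAt.eventually_lt continuousAt_const (by simpa using hδ)
      filter_upwards [this] with y hy using hconst _ hy
    · exact (hp.contDiffAt (x := ‖x‖)).comp x (contDiffAt_norm ℝ hx)
  · exact HasCompactSupport.intro' (isCompact_closedBall (0 : E n) (1 - δ)) isClosed_closedBall
      fun x hx => hzero _ (by simpa using hx)
  · exact hsupp.trans (closedBall_subset_ball (by linarith))
  · exact gradient_radial hx (hasDerivAt_prim hk.continuous _)

/-- Smooth functions with compact support in `(0, 1)` are dense. -/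
theorem exists_smooth_near {n : ℕ} {k : ℝ → ℝ} (hk : MemLp k 2 (radMeasure n)) {ε : ℝ≥0∞}
    (hε : 0 < ε) : ∃ g : ℝ → ℝ, ContDiff ℝ ∞ g ∧ HasCompactSupport g ∧ tsupport g ⊆ Ioo (0 : ℝ) 1 ∧
      eLpNorm (k - g) 2 (radMeasure n) < ε := by
  have hmem : ∀ g : ℝ → ℝ, ContDiff ℝ ∞ g → HasCompactSupport g → MemLp g 2 (radMeasure n) :=
    fun g h1 h2 => h1.continuous.memLp_of_hasCompactSupport h2
  let K : Submodule ℝ (Lp ℝ 2 (radMeasure n)) :=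
    { carrier := {f | ∃ g : ℝ → ℝ, ContDiff ℝ ∞ g ∧ HasCompactSupport g ∧
        tsupport g ⊆ Ioo (0 : ℝ) 1 ∧ f =ᵐ[radMeasure n] g}
      zero_mem' := ⟨0, contDiff_const, HasCompactSupport.zero, by simp [tsupport],
        Lp.coeFn_zero _ _ _⟩
      add_mem' := by
        rintro f f' ⟨g, h1, h2, h3, h4⟩ ⟨g', h1', h2', h3', h4'⟩
        exact ⟨g + g', h1.add h1', h2.add h2', (tsupport_add _ _).trans (union_subset h3 h3'),
          (Lp.coeFn_add f f').trans (h4.add h4')⟩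
      smul_mem' := by
        rintro c f ⟨g, h1, h2, h3, h4⟩
        refine ⟨c • g, h1.const_smul c, h2.smul_left (f := fun _ => c),
          (closure_mono ?_).trans h3, (Lp.coeFn_smul c f).trans (h4.const_smul c)⟩
        exact Function.support_const_smul_subset c g }
  -- Density by duality: a function orthogonal to all smooth functions supported in `(0, 1)`
  -- vanishes almost everywhere.
  have hK : K.topologicalClosure = ⊤ := by
    rw [Submodule.topologicalClosure_eq_top_iff, Submodule.eq_bot_iff]
    intro f hf
    rw [Lp.eq_zero_iff_ae_eq_zero]
    have hint : Integrable f (radMeasure n) := (Lp.memLp f).integrable (by norm_num)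
    have := isOpen_Ioo.ae_eq_zero_of_integral_contDiff_smul_eq_zero (U := Ioo (0 : ℝ) 1)
      (hint.locallyIntegrable.locallyIntegrableOn _) (fun g h1 h2 h3 => ?_)
    · filter_upwards [this, ae_radMeasure_mem n] with r h1 h2 using h1 h2
    · have h := (Submodule.mem_orthogonal _ _).1 hf ((hmem g h1 h2).toLp g)
        ⟨g, h1, h2, h3, (hmem g h1 h2).coeFn_toLp⟩
      rw [L2.inner_def] at h
      rw [← h]
      refine integral_congr_ae ?_
      filter_upwards [(hmem g h1 h2).coeFn_toLp] with r hr
      rw [hr]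
      simp [mul_comm]
  have : hk.toLp k ∈ closure (K : Set _) := by
    rw [← Submodule.topologicalClosure_coe, hK]; trivial
  obtain ⟨f, ⟨g, h1, h2, h3, h4⟩, h5⟩ := EMetric.mem_closure_iff.1 this ε hε
  refine ⟨g, h1, h2, h3, ?_⟩
  rw [Lp.edist_def] at h5
  rwa [eLpNorm_congr_ae (hk.coeFn_toLp.sub h4)] at h5

/-- On `(r, 1)` the density is at least `r ^ (n - 1)`. The weight therefore degenerates only at the
origin, and weighted square integrability gives ordinary integrability away from it. -/
lemma restrict_Ioo_le {n : ℕ} {r : ℝ} (hr : 0 < r) :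
    volume.restrict (Ioo r 1) ≤ ENNReal.ofReal ((r ^ (n - 1))⁻¹) • radMeasure n := by
  rw [Measure.le_iff]
  intro s hs
  have hp : 0 < r ^ (n - 1) := by positivity
  rw [Measure.smul_apply, smul_eq_mul, radMeasure, withDensity_apply _ hs,
    Measure.restrict_restrict hs, Measure.restrict_apply hs,
    ← lintegral_const_mul _ (by fun_prop)]
  calc volume (s ∩ Ioo r 1) = ∫⁻ _ in s ∩ Ioo r 1, 1 := by simp
    _ ≤ ∫⁻ t in s ∩ Ioo r 1, ENNReal.ofReal ((r ^ (n - 1))⁻¹) * ENNReal.ofReal (t ^ (n - 1)) := by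
      refine setLIntegral_mono (by fun_prop) fun t ht => ?_
      rw [← ENNReal.ofReal_mul (by positivity), ← ENNReal.ofReal_one]
      refine ENNReal.ofReal_le_ofReal ?_
      rw [inv_mul_eq_div, one_le_div hp]
      exact pow_le_pow_left₀ hr.le ht.2.1.le _
    _ ≤ _ := lintegral_mono_set fun t ht =>
      (⟨ht.1, hr.trans ht.2.1, ht.2.2⟩ : t ∈ s ∩ Ioo (0 : ℝ) 1)

lemma integrableOn_of_memLp_rad {n : ℕ} {k : ℝ → ℝ} (hk : MemLp k 2 (radMeasure n)) {r : ℝ}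
    (hr : 0 < r) : IntegrableOn k (Ioc r 1) := by
  rw [integrableOn_Ioc_iff_integrableOn_Ioo]
  exact (hk.of_measure_le_smul (by simp) (restrict_Ioo_le hr)).integrable (by norm_num)

lemma intervalIntegrable_of_integrableOn {k : ℝ → ℝ}
    (hk : ∀ r, 0 < r → IntegrableOn k (Ioc r 1)) {a b : ℝ} (ha : 0 < a) (ha1 : a ≤ 1) (hb : 0 < b)
    (hb1 : b ≤ 1) : IntervalIntegrable k volume a b := by
  rw [intervalIntegrable_iff]
  refine (hk (min a b) (lt_min ha hb)).mono_set ?_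
  rw [uIoc]
  exact Ioc_subset_Ioc_right (max_le ha1 hb1)

lemma continuousOn_prim {k : ℝ → ℝ} (hk : ∀ r, 0 < r → IntegrableOn k (Ioc r 1)) :
    ContinuousOn (prim k) (Ioc 0 1) := by
  have h : ∀ ε, 0 < ε → ε ≤ 1 → ContinuousOn (prim k) (Icc ε 1) := by
    intro ε h0 h1
    have h2 : IntegrableOn k (uIcc ε 1) := by
      rw [uIcc_of_le h1, integrableOn_Icc_iff_integrableOn_Ioc]; exact hk ε h0
    have := (intervalIntegral.continuousOn_primitive_interval_left h2).neg
    rwa [uIcc_of_le h1] at this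
  intro r hr
  have h1 := h (r / 2) (by linarith [hr.1]) (by linarith [hr.1, hr.2]) r
    ⟨by linarith [hr.1], hr.2⟩
  refine (h1.mono_of_mem_nhdsWithin ?_)
  have : Ioi (r / 2) ∈ nhds r := Ioi_mem_nhds (by linarith [hr.1])
  filter_upwards [mem_nhdsWithin_of_mem_nhds this, self_mem_nhdsWithin] with t h3 h4
  exact ⟨le_of_lt h3, h4.2⟩

lemma aestronglyMeasurable_rad_of_continuousOn {n : ℕ} {h : ℝ → ℝ} (hh : ContinuousOn h (Ioo 0 1)) :
    AEStronglyMeasurable h (radMeasure n) :=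
  (hh.aestronglyMeasurable measurableSet_Ioo).mono_measure (radMeasure_le n)

/-- A Hardy type inequality. -/
lemma eLpNorm_prim_le {n : ℕ} {k : ℝ → ℝ} (hk : MemLp k 2 (radMeasure n)) :
    eLpNorm (prim k) 2 (radMeasure n) ≤ eLpNorm k 2 (radMeasure n) := by
  set N := eLpNorm k 2 (radMeasure n)
  -- Cauchy–Schwarz on `(r, 1)` costs a factor `r ^ (-(n - 1))`, which the density absorbs. The
  -- squared weighted integrand is thus bounded pointwise, and `(0, 1)` has length one.
  have hpt : ∀ r ∈ Ioo (0 : ℝ) 1,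
      ‖prim k r‖ₑ ^ (2 : ℝ) * ENNReal.ofReal (r ^ (n - 1)) ≤ N ^ (2 : ℝ) := by
    intro r hr
    have hp : 0 < r ^ (n - 1) := pow_pos hr.1 _
    have h1 : ‖prim k r‖ₑ ≤ eLpNorm k 1 (volume.restrict (Ioo r 1)) := by
      rw [prim, enorm_neg, intervalIntegral.integral_of_le hr.2.le, integral_Ioc_eq_integral_Ioo,
        eLpNorm_one_eq_lintegral_enorm]
      exact enorm_integral_le_lintegral_enorm _
    have h2 : eLpNorm k 1 (volume.restrict (Ioo r 1)) ≤ eLpNorm k 2 (volume.restrict (Ioo r 1)) := by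
      have hm : AEStronglyMeasurable k (volume.restrict (Ioo r 1)) :=
        (hk.of_measure_le_smul (by simp) (restrict_Ioo_le hr.1)).1
      refine (eLpNorm_le_eLpNorm_mul_rpow_measure_univ (p := 1) (q := 2) (by norm_num) hm).trans ?_
      refine mul_le_of_le_one_right' (ENNReal.rpow_le_one ?_ (by norm_num))
      simp only [Measure.restrict_apply_univ, Real.volume_Ioo]
      exact ENNReal.ofReal_le_one.2 (by linarith [hr.1])
    have h3 : eLpNorm k 2 (volume.restrict (Ioo r 1))
        ≤ ENNReal.ofReal ((r ^ (n - 1))⁻¹) ^ (1 / 2 : ℝ) * N := by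
      refine (eLpNorm_mono_measure k (restrict_Ioo_le (n := n) hr.1)).trans ?_
      rw [eLpNorm_smul_measure_of_ne_top (by norm_num)]
      simp [N]
    have h4 := ENNReal.rpow_le_rpow (h1.trans (h2.trans h3)) (show (0 : ℝ) ≤ 2 by norm_num)
    rw [ENNReal.mul_rpow_of_nonneg _ _ (by norm_num), ← ENNReal.rpow_mul] at h4
    norm_num at h4
    calc _ ≤ ENNReal.ofReal ((r ^ (n - 1))⁻¹) * N ^ (2 : ℝ) * ENNReal.ofReal (r ^ (n - 1)) := by
          gcongr; simpa using h4
      _ = N ^ (2 : ℝ) := by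
        rw [mul_right_comm, ← ENNReal.ofReal_mul (by positivity), inv_mul_cancel₀ hp.ne']
        simp
  rw [eLpNorm_eq_lintegral_rpow_enorm_toReal (by norm_num) (by norm_num)]
  simp only [ENNReal.toReal_ofNat]
  have hm : AEMeasurable (fun r => ‖prim k r‖ₑ ^ (2 : ℝ)) (volume.restrict (Ioo (0 : ℝ) 1)) := by
    have := ((continuousOn_prim fun _ hr => integrableOn_of_memLp_rad hk hr).mono
      Ioo_subset_Ioc_self).aestronglyMeasurable (μ := volume) measurableSet_Ioo
    exact this.enorm.pow_const _
  have : ∫⁻ r, ‖prim k r‖ₑ ^ (2 : ℝ) ∂radMeasure n ≤ N ^ (2 : ℝ) := by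
    rw [radMeasure, lintegral_withDensity_eq_lintegral_mul₀ (by fun_prop) hm]
    calc _ ≤ ∫⁻ r in Ioo (0 : ℝ) 1, N ^ (2 : ℝ) := by
          refine setLIntegral_mono (by fun_prop) fun r hr => ?_
          simpa [mul_comm] using hpt r hr
      _ = N ^ (2 : ℝ) := by simp
  calc _ ≤ (N ^ (2 : ℝ)) ^ (1 / 2 : ℝ) := by gcongr
    _ = N := by rw [← ENNReal.rpow_mul]; norm_num

lemma aestronglyMeasurable_comp_norm {n : ℕ} (hn : 1 ≤ n) {h : ℝ → ℝ}
    (hh : AEStronglyMeasurable h (radMeasure n)) :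
    AEStronglyMeasurable (fun x : E n => h ‖x‖) (ballMeasure n) := by
  have : AEStronglyMeasurable h ((ballMeasure n).map norm) := by
    rw [map_norm_ballMeasure hn]; exact hh.smul_measure _
  exact this.comp_aemeasurable measurable_norm.aemeasurable

lemma eLpNorm_comp_norm {n : ℕ} (hn : 1 ≤ n) {h : ℝ → ℝ}
    (hh : AEStronglyMeasurable h (radMeasure n)) :
    eLpNorm (fun x : E n => h ‖x‖) 2 (ballMeasure n)
      = area n ^ (1 / 2 : ℝ) * eLpNorm h 2 (radMeasure n) := by
  have h1 : AEStronglyMeasurable h ((ballMeasure n).map norm) := by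
    rw [map_norm_ballMeasure hn]; exact hh.smul_measure _
  have h2 := eLpNorm_map_measure (p := 2) h1 measurable_norm.aemeasurable
  rw [map_norm_ballMeasure hn, eLpNorm_smul_measure_of_ne_top (by norm_num)] at h2
  simpa [Function.comp_def] using h2.symm

/-- The radial vector field with profile `k`. -/
noncomputable def radField (n : ℕ) (k : ℝ → ℝ) (x : E n) : E n := (k ‖x‖ / ‖x‖) • x

lemma norm_radField {n : ℕ} (k : ℝ → ℝ) {x : E n} (hx : x ≠ 0) : ‖radField n k x‖ = ‖k ‖x‖‖ := by
  have : ‖x‖ ≠ 0 := by simpa using hx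
  rw [radField, norm_smul, norm_div, norm_norm, div_mul_cancel₀ _ this]

lemma ae_ne_zero {n : ℕ} (hn : 1 ≤ n) : ∀ᵐ x ∂ballMeasure n, x ≠ 0 := by
  filter_upwards [ae_norm_iff hn (ae_radMeasure_mem n)] with x hx h
  simp [h] at hx

lemma eLpNorm_radField {n : ℕ} (hn : 1 ≤ n) {k : ℝ → ℝ}
    (hk : AEStronglyMeasurable k (radMeasure n)) :
    eLpNorm (radField n k) 2 (ballMeasure n)
      = area n ^ (1 / 2 : ℝ) * eLpNorm k 2 (radMeasure n) := by
  rw [← eLpNorm_comp_norm hn hk]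
  refine eLpNorm_congr_norm_ae ?_
  filter_upwards [ae_ne_zero hn] with x hx using norm_radField k hx

lemma aestronglyMeasurable_radField {n : ℕ} (hn : 1 ≤ n) {k : ℝ → ℝ}
    (hk : AEStronglyMeasurable k (radMeasure n)) :
    AEStronglyMeasurable (radField n k) (ballMeasure n) := by
  unfold radField
  have h2 : AEStronglyMeasurable (fun x : E n => ‖x‖⁻¹) (ballMeasure n) :=
    measurable_norm.inv.aestronglyMeasurable
  simp_rw [div_eq_mul_inv]
  exact ((aestronglyMeasurable_comp_norm hn hk).mul h2).smul aestronglyMeasurable_id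

lemma area_rpow_ne_top (n : ℕ) : area n ^ (1 / 2 : ℝ) ≠ ⊤ :=
  ENNReal.rpow_ne_top_of_nonneg (by norm_num) (area_ne_top n)

lemma memLp_comp_norm {n : ℕ} (hn : 1 ≤ n) {h : ℝ → ℝ} (hh : MemLp h 2 (radMeasure n)) :
    MemLp (fun x : E n => h ‖x‖) 2 (ballMeasure n) := by
  refine ⟨aestronglyMeasurable_comp_norm hn hh.1, ?_⟩
  rw [eLpNorm_comp_norm hn hh.1]
  exact ENNReal.mul_lt_top (area_rpow_ne_top n).lt_top hh.2

lemma memLp_radField {n : ℕ} (hn : 1 ≤ n) {k : ℝ → ℝ} (hk : MemLp k 2 (radMeasure n)) :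
    MemLp (radField n k) 2 (ballMeasure n) := by
  refine ⟨aestronglyMeasurable_radField hn hk.1, ?_⟩
  rw [eLpNorm_radField hn hk.1]
  exact ENNReal.mul_lt_top (area_rpow_ne_top n).lt_top hk.2

lemma memLp_prim {n : ℕ} {k : ℝ → ℝ} (hk : MemLp k 2 (radMeasure n)) :
    MemLp (prim k) 2 (radMeasure n) :=
  ⟨aestronglyMeasurable_rad_of_continuousOn
    ((continuousOn_prim fun _ hr => integrableOn_of_memLp_rad hk hr).mono Ioo_subset_Ioc_self),
    (eLpNorm_prim_le hk).trans_lt hk.2⟩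

/-- The element of `H¹₀` with radial derivative `k`. -/
theorem exists_H10_prim {n : ℕ} (hn : 1 ≤ n) {k : ℝ → ℝ} (hk : MemLp k 2 (radMeasure n)) :
    ∃ η : H10 n, (fn η =ᵐ[ballMeasure n] fun x => prim k ‖x‖) ∧
      grad η =ᵐ[ballMeasure n] radField n k := by
  have hp1 := memLp_comp_norm hn (memLp_prim hk)
  have hp2 := memLp_radField hn hk
  refine ⟨⟨(hp1.toLp _, hp2.toLp _), mem_H10_iff.2 (EMetric.mem_closure_iff.2 fun ε hε => ?_)⟩,
    hp1.coeFn_toLp, hp2.coeFn_toLp⟩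
  set c := area n ^ (1 / 2 : ℝ)
  have hc0 : c ≠ 0 := by simp [c, area_ne_zero hn, area_ne_top n]
  have hct : c ≠ ⊤ := area_rpow_ne_top n
  -- Approximating the derivative suffices: the Hardy bound transfers the estimate to the function,
  -- and both `L²` norms on the ball carry the same factor `c`.
  obtain ⟨g, h1, h2, h3, h4⟩ := exists_smooth_near hk (ENNReal.div_pos hε.ne' hct)
  obtain ⟨η, he, hg⟩ := exists_test_prim (n := n) h1 h2 h3
  refine ⟨_, mem_testPairs_of_test η, ?_⟩
  have hgm : MemLp g 2 (radMeasure n) := h1.continuous.memLp_of_hasCompactSupport h2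
  have hsub := hk.sub hgm
  have h5 : c * eLpNorm (k - g) 2 (radMeasure n) < ε := by
    rw [mul_comm]; exact (ENNReal.lt_div_iff_mul_lt (.inl hc0) (.inl hct)).1 h4
  rw [Prod.edist_eq, max_lt_iff, Lp.edist_toLp_toLp, Lp.edist_toLp_toLp]
  constructor
  · refine lt_of_le_of_lt ?_ h5
    have : ((fun x : E n => prim k ‖x‖) - (η : E n → ℝ)) =ᵐ[ballMeasure n]
        fun x => prim (k - g) ‖x‖ := by
      filter_upwards [ae_norm_iff hn (ae_radMeasure_mem n)] with x hx
      have i1 := intervalIntegrable_of_integrableOn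
        (fun _ hr => integrableOn_of_memLp_rad hk hr) hx.1 hx.2.le one_pos le_rfl
      simp only [Pi.sub_apply, he, prim]
      rw [intervalIntegral.integral_sub i1 (h1.continuous.intervalIntegrable _ _)]
      ring
    rw [eLpNorm_congr_ae this, eLpNorm_comp_norm hn (memLp_prim hsub).1]
    gcongr
    exact eLpNorm_prim_le hsub
  · refine lt_of_le_of_lt (le_of_eq ?_) h5
    rw [← eLpNorm_radField hn hsub.1]
    refine eLpNorm_congr_ae ?_
    filter_upwards [ae_ne_zero hn] with x hx
    simp [hg x hx, radField, sub_div, sub_smul]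

/-! ### The explicit radial solution of `-Δu = F`. -/

lemma integrable_inner_of_memLp {n : ℕ} {X Y : E n → E n} (hX : MemLp X 2 (ballMeasure n))
    (hY : MemLp Y 2 (ballMeasure n)) : Integrable (fun x => ⟪X x, Y x⟫_ℝ) (ballMeasure n) := by
  refine (L2.integrable_inner (𝕜 := ℝ) (hX.toLp X) (hY.toLp Y)).congr ?_
  filter_upwards [hX.coeFn_toLp, hY.coeFn_toLp] with x h1 h2
  rw [h1, h2]

lemma integral_ball_eq_prod {n : ℕ} (hn : 1 ≤ n) {u : E n → ℝ} (hu : Integrable u (ballMeasure n)) :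
    Integrable (fun p => u (polar p)) ((sphereMeasure n).prod (radMeasure n)) ∧
      ∫ x in ball (0 : E n) 1, u x
        = ∫ p, u (polar p) ∂(sphereMeasure n).prod (radMeasure n) := by
  have h := measurePreserving_polar hn
  refine ⟨h.integrable_comp_of_integrable hu, ?_⟩
  have h1 : AEStronglyMeasurable u (((sphereMeasure n).prod (radMeasure n)).map polar) := by
    rw [h.map_eq]; exact hu.1
  rw [← integral_map h.measurable.aemeasurable h1, h.map_eq]

lemma integral_ball_polar {n : ℕ} (hn : 1 ≤ n) {u : E n → ℝ} (hu : Integrable u (ballMeasure n)) :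
    ∫ x in ball (0 : E n) 1, u x
      = ∫ w, (∫ r in Ioo (0 : ℝ) 1, r ^ (n - 1) * u (polar (w, r))) ∂sphereMeasure n := by
  obtain ⟨h1, h2⟩ := integral_ball_eq_prod hn hu
  rw [h2, integral_prod _ h1]
  simp_rw [integral_radMeasure]

lemma integral_ball_polar_symm {n : ℕ} (hn : 1 ≤ n) {u : E n → ℝ}
    (hu : Integrable u (ballMeasure n)) :
    ∫ x in ball (0 : E n) 1, u x
      = ∫ r, ∫ w, u (polar (w, r)) ∂sphereMeasure n ∂radMeasure n := by
  obtain ⟨h1, h2⟩ := integral_ball_eq_prod hn hu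
  rw [h2, integral_prod_symm _ h1]

/-- The flux `∫₀ʳ tⁿ⁻¹ F(t) dt`. -/
noncomputable def flux (n : ℕ) (F : ℝ → ℝ) (r : ℝ) : ℝ := ∫ t in (0 : ℝ)..r, t ^ (n - 1) * F t

/-- The radial derivative of the solution of `-Δu = F`. -/
noncomputable def radSlope (n : ℕ) (F : ℝ → ℝ) (r : ℝ) : ℝ := -(flux n F r / r ^ (n - 1))

lemma intervalIntegrable_flux {n : ℕ} {F : ℝ → ℝ} (hF : Integrable F (radMeasure n)) :
    IntervalIntegrable (fun t => t ^ (n - 1) * F t) volume 0 1 := by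
  rw [intervalIntegrable_iff, uIoc_of_le zero_le_one, integrableOn_Ioc_iff_integrableOn_Ioo]
  exact integrable_radMeasure_iff.1 hF

lemma continuousOn_flux {n : ℕ} {F : ℝ → ℝ} (hF : Integrable F (radMeasure n)) :
    ContinuousOn (flux n F) (Icc 0 1) := by
  have := intervalIntegral.continuousOn_primitive_interval'
    (intervalIntegrable_flux hF) left_mem_uIcc
  rwa [uIcc_of_le zero_le_one] at this

lemma continuousOn_slope {n : ℕ} {F : ℝ → ℝ} (hF : Integrable F (radMeasure n)) :
    ContinuousOn (radSlope n F) (Ioc 0 1) :=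
  (((continuousOn_flux hF).mono Ioc_subset_Icc_self).div (by fun_prop)
    fun r hr => (pow_pos hr.1 _).ne').neg

lemma radMeasure_Ioo_le {n : ℕ} (hn : 1 ≤ n) {r : ℝ} (hr : 0 < r) :
    radMeasure n (Ioo 0 r) ≤ ENNReal.ofReal (r ^ n) := by
  rw [radMeasure, withDensity_apply _ measurableSet_Ioo,
    Measure.restrict_restrict measurableSet_Ioo]
  calc _ ≤ ∫⁻ t in Ioo 0 r, ENNReal.ofReal (t ^ (n - 1)) :=
        lintegral_mono_set inter_subset_left
    _ ≤ ∫⁻ t in Ioo 0 r, ENNReal.ofReal (r ^ (n - 1)) := by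
        refine setLIntegral_mono (by fun_prop) fun t ht => ?_
        exact ENNReal.ofReal_le_ofReal (pow_le_pow_left₀ ht.1.le ht.2.le _)
    _ = ENNReal.ofReal (r ^ n) := by
        rw [setLIntegral_const, Real.volume_Ioo, sub_zero, ← ENNReal.ofReal_mul (by positivity),
          ← pow_succ, Nat.sub_add_cancel hn]

/-- Cauchy–Schwarz on `(0, r)`, whose weighted mass is at most `r ^ n`, bounds the squared flux by
`N² r ^ n`. After division by `r ^ (2 (n - 1))` and multiplication by the density, `N² r` remains.
-/
lemma memLp_slope {n : ℕ} (hn : 1 ≤ n) {F : ℝ → ℝ} (hF : MemLp F 2 (radMeasure n)) :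
    MemLp (radSlope n F) 2 (radMeasure n) := by
  have hFi : Integrable F (radMeasure n) := hF.integrable (by norm_num)
  have hc := (continuousOn_slope hFi).mono Ioo_subset_Ioc_self
  refine ⟨aestronglyMeasurable_rad_of_continuousOn hc, ?_⟩
  set N := eLpNorm F 2 (radMeasure n)
  have hpt : ∀ r ∈ Ioo (0 : ℝ) 1,
      ‖radSlope n F r‖ₑ ^ (2 : ℝ) * ENNReal.ofReal (r ^ (n - 1)) ≤ N ^ (2 : ℝ) := by
    intro r hr
    have hr0 := hr.1
    have hp : 0 < r ^ (n - 1) := pow_pos hr.1 _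
    have h1 : ‖flux n F r‖ₑ ≤ eLpNorm F 1 ((radMeasure n).restrict (Ioo 0 r)) := by
      rw [flux, intervalIntegral.integral_of_le hr.1.le, integral_Ioc_eq_integral_Ioo,
        eLpNorm_one_eq_lintegral_enorm]
      have : ∫ t in Ioo 0 r, t ^ (n - 1) * F t = ∫ t in Ioo 0 r, F t ∂radMeasure n := by
        rw [← integral_indicator measurableSet_Ioo, ← integral_indicator measurableSet_Ioo,
          integral_radMeasure, ← integral_indicator measurableSet_Ioo]
        congr 1
        ext t
        simp only [indicator]
        split_ifs with h1 h2 h2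
        · rfl
        · exact absurd ⟨h1.1, h1.2.trans hr.2⟩ h2
        · simp
        · rfl
      rw [this]
      exact enorm_integral_le_lintegral_enorm _
    have h2 : eLpNorm F 1 ((radMeasure n).restrict (Ioo 0 r))
        ≤ N * ENNReal.ofReal (r ^ n) ^ (1 / 2 : ℝ) := by
      refine (eLpNorm_le_eLpNorm_mul_rpow_measure_univ (p := 1) (q := 2) (by norm_num)
        hF.1.restrict).trans ?_
      gcongr
      · exact eLpNorm_mono_measure _ Measure.restrict_le_self
      · norm_num
        exact ENNReal.rpow_le_rpow (radMeasure_Ioo_le hn hr.1) (by norm_num)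
    have h3 := ENNReal.rpow_le_rpow (h1.trans h2) (show (0 : ℝ) ≤ 2 by norm_num)
    rw [ENNReal.mul_rpow_of_nonneg _ _ (by norm_num), ← ENNReal.rpow_mul] at h3
    norm_num at h3
    have h4 : ‖radSlope n F r‖ₑ = ‖flux n F r‖ₑ * ENNReal.ofReal ((r ^ (n - 1))⁻¹) := by
      rw [radSlope, enorm_neg, div_eq_mul_inv, enorm_mul]
      congr 1
      rw [Real.enorm_eq_ofReal (by positivity)]
    rw [h4, ENNReal.mul_rpow_of_nonneg _ _ (by norm_num)]
    calc _ ≤ N ^ (2 : ℝ) * ENNReal.ofReal (r ^ n) * ENNReal.ofReal ((r ^ (n - 1))⁻¹) ^ (2 : ℝ)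
          * ENNReal.ofReal (r ^ (n - 1)) := by
          gcongr; simpa using h3
      _ = N ^ (2 : ℝ) * ENNReal.ofReal r := by
        rw [ENNReal.ofReal_rpow_of_nonneg (by positivity) (by norm_num), mul_assoc, mul_assoc,
          ← ENNReal.ofReal_mul (by positivity), ← ENNReal.ofReal_mul (by positivity)]
        congr 2
        norm_num
        obtain ⟨m, rfl⟩ : ∃ m, n = m + 1 := ⟨n - 1, by omega⟩
        simp only [Nat.add_sub_cancel]
        field_simp
        ring
      _ ≤ N ^ (2 : ℝ) := by
        refine mul_le_of_le_one_right' (ENNReal.ofReal_le_one.2 hr.2.le)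
  rw [eLpNorm_lt_top_iff_lintegral_rpow_enorm_lt_top (by norm_num) (by norm_num)]
  simp only [ENNReal.toReal_ofNat]
  have hm : AEMeasurable (fun r => ‖radSlope n F r‖ₑ ^ (2 : ℝ)) (volume.restrict (Ioo (0 : ℝ) 1)) :=
    (hc.aestronglyMeasurable (μ := volume) measurableSet_Ioo).enorm.pow_const _
  rw [radMeasure, lintegral_withDensity_eq_lintegral_mul₀ (by fun_prop) hm]
  calc _ ≤ ∫⁻ r in Ioo (0 : ℝ) 1, N ^ (2 : ℝ) := by
        refine setLIntegral_mono (by fun_prop) fun r hr => ?_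
        simpa [mul_comm] using hpt r hr
    _ = N ^ (2 : ℝ) := by simp
    _ < ⊤ := ENNReal.rpow_lt_top_of_nonneg (by norm_num) hF.2.ne

/-- As `F` is only integrable, the flux is merely absolutely continuous, which is enough to
integrate by parts. Both boundary terms vanish: the flux at `0`, and `z` at `1`. -/
lemma integral_flux_mul_deriv {n : ℕ} {F : ℝ → ℝ} (hF : Integrable F (radMeasure n))
    {z : ℝ → ℝ} (hz : ContDiff ℝ 1 z) (hz1 : z 1 = 0) :
    ∫ r in Ioo (0 : ℝ) 1, flux n F r * deriv z r
      = -∫ r in Ioo (0 : ℝ) 1, r ^ (n - 1) * F r * z r := by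
  have hi := intervalIntegrable_flux hF
  have h1 : AbsolutelyContinuousOnInterval (flux n F) 0 1 :=
    hi.absolutelyContinuousOnInterval_intervalIntegral (by simp)
  have h2 : AbsolutelyContinuousOnInterval z 0 1 :=
    hz.contDiffOn.absolutelyContinuousOnInterval
  have h3 := h1.integral_mul_deriv_eq_deriv_mul h2
  rw [← integral_Ioc_eq_integral_Ioo, ← integral_Ioc_eq_integral_Ioo,
    ← intervalIntegral.integral_of_le zero_le_one, ← intervalIntegral.integral_of_le zero_le_one,
    h3, hz1]
  simp only [flux, intervalIntegral.integral_same, mul_zero, zero_mul, sub_zero, zero_sub]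
  congr 1
  refine intervalIntegral.integral_congr_ae ?_
  filter_upwards [hi.ae_hasDerivAt_integral] with r hr hr'
  have h4 : deriv (flux n F) r = r ^ (n - 1) * F r :=
    (hr (uIoc_subset_uIcc hr') 0 (by simp)).deriv
  rw [h4]

/-- The radial field `radSlope n F` is a weak solution of `-div X = F`. -/
theorem weak_radial {n : ℕ} (hn : 1 ≤ n) {F : ℝ → ℝ} (hF : MemLp F 2 (radMeasure n))
    (η : 𝓓(unitBall n, ℝ)) :
    ∫ x in ball (0 : E n) 1, ⟪radField n (radSlope n F) x, ∇ (η : E n → ℝ) x⟫_ℝ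
      = ∫ x in ball (0 : E n) 1, F ‖x‖ * η x := by
  have hFi : Integrable F (radMeasure n) := hF.integrable (by norm_num)
  have i1 : Integrable (fun x => ⟪radField n (radSlope n F) x, ∇ (η : E n → ℝ) x⟫_ℝ)
      (ballMeasure n) :=
    integrable_inner_of_memLp (memLp_radField hn (memLp_slope hn hF))
      (memLp_ball_of_continuous (continuous_gradient_test η).continuousOn 2)
  have i2 : Integrable (fun x => F ‖x‖ * η x) (ballMeasure n) :=
    (memLp_comp_norm hn hF).integrable_mul
      (memLp_ball_of_continuous η.continuous.continuousOn 2)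
  -- The identity holds on every ray separately. The Jacobian cancels the denominator of `radSlope`,
  -- leaving the flux times the derivative of `η` along the ray, so the origin needs no excision.
  rw [integral_ball_polar hn i1, integral_ball_polar hn i2]
  congr 1
  ext w
  have hw : ‖(w : E n)‖ = 1 := by simp
  have hz : ContDiff ℝ 1 fun r : ℝ => η (r • (w : E n)) :=
    ((contDiff_test η).of_le (by simp)).comp (contDiff_id.smul contDiff_const)
  have hd : ∀ r : ℝ, deriv (fun r : ℝ => η (r • (w : E n))) r
      = ⟪(w : E n), ∇ (η : E n → ℝ) (r • (w : E n))⟫_ℝ := by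
    intro r
    have h1 := (differentiable_test η (r • (w : E n))).hasFDerivAt.comp_hasDerivAt r
      ((hasDerivAt_id r).smul_const (w : E n))
    have h2 : deriv (fun r : ℝ => η (r • (w : E n))) r
      = fderiv ℝ (η : E n → ℝ) (r • (w : E n)) ((1 : ℝ) • (w : E n)) := h1.deriv
    rw [h2, one_smul, real_inner_comm, gradient, InnerProductSpace.toDual_symm_apply]
  have h := integral_flux_mul_deriv hFi hz (by
    rw [one_smul]; exact test_eq_zero η (by simp))
  have e1 : ∫ r in Ioo (0 : ℝ) 1, r ^ (n - 1) *
      ⟪radField n (radSlope n F) (polar (w, r)), ∇ (η : E n → ℝ) (polar (w, r))⟫_ℝ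
      = -∫ r in Ioo (0 : ℝ) 1, flux n F r * deriv (fun r : ℝ => η (r • (w : E n))) r := by
    rw [← integral_neg]
    refine setIntegral_congr_fun measurableSet_Ioo fun r hr => ?_
    have hr0 : r ≠ 0 := hr.1.ne'
    simp only [radField, norm_polar, abs_of_pos hr.1, hd, radSlope]
    simp only [polar, smul_smul, inner_smul_left]
    simp
    field_simp
  rw [e1, h, neg_neg]
  refine setIntegral_congr_fun measurableSet_Ioo fun r hr => ?_
  have e2 : ‖polar (w, r)‖ = r := by rw [norm_polar]; exact abs_of_pos hr.1
  simp only [e2]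
  simp only [polar]
  ring

/-- A radial `φ ∈ H¹₀` with `-Δφ = F(|x|)`, tested with radial functions only, is the explicit
radial solution. -/
theorem radial_weak_unique {n : ℕ} (hn : 2 ≤ n) {F g : ℝ → ℝ} (hF : MemLp F 2 (radMeasure n))
    (hg : MemLp g 2 (radMeasure n)) {φ : H10 n} (hφ : fn φ =ᵐ[ballMeasure n] fun x => g ‖x‖)
    (h : ∀ (η : H10 n) (d : ℝ → ℝ), MemLp d 2 (radMeasure n) →
      (fn η =ᵐ[ballMeasure n] fun x => d ‖x‖) →
      ∫ x in ball (0 : E n) 1, ⟪grad φ x, grad η x⟫_ℝ = ∫ x in ball (0 : E n) 1, F ‖x‖ * fn η x) :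
    (fn φ =ᵐ[ballMeasure n] fun x => prim (radSlope n F) ‖x‖) ∧
      grad φ =ᵐ[ballMeasure n] radField n (radSlope n F) := by
  have hn1 : 1 ≤ n := by omega
  have hs := memLp_slope hn1 hF
  obtain ⟨u, hu1, hu2⟩ := exists_H10_prim hn1 hs
  have hD : fn (φ - u) =ᵐ[ballMeasure n] fun x => (g - prim (radSlope n F)) ‖x‖ := by
    filter_upwards [fn_sub φ u, hφ, hu1] with x h1 h2 h3
    rw [h1, h2, h3]; rfl
  -- The difference from the explicit solution is itself radial, hence an allowed test function.
  -- Testing with it shows that its gradient vanishes.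
  have e1 := h (φ - u) _ (hg.sub (memLp_prim hs)) hD
  have e2 := weak_of_test (memLp_radField hn1 hs) (memLp_comp_norm hn1 hF)
    (weak_radial hn1 hF) (φ - u)
  have e3 : ∫ x in ball (0 : E n) 1, ⟪grad (φ - u) x, grad (φ - u) x⟫_ℝ = 0 := by
    have : ∫ x in ball (0 : E n) 1, ⟪grad (φ - u) x, grad (φ - u) x⟫_ℝ
        = ∫ x in ball (0 : E n) 1, (⟪grad φ x, grad (φ - u) x⟫_ℝ
          - ⟪radField n (radSlope n F) x, grad (φ - u) x⟫_ℝ) := by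
      refine integral_congr_ae ?_
      filter_upwards [grad_sub φ u, hu2] with x h1 h2
      rw [← h2, ← inner_sub_left, ← h1]
    rw [this, integral_sub (integrable_inner_of_memLp (memLp_grad φ) (memLp_grad _))
      (integrable_inner_of_memLp (memLp_radField hn1 hs) (memLp_grad _)), e1, e2, sub_self]
  have e4 : grad (φ - u) =ᵐ[ballMeasure n] 0 := by
    rw [integral_eq_zero_iff_of_nonneg (fun x => real_inner_self_nonneg)
      (integrable_inner_of_memLp (memLp_grad _) (memLp_grad _))] at e3
    filter_upwards [e3] with x hx
    simpa using hx
  have e5 : φ = u := sub_eq_zero.1 (eq_zero_of_grad hn e4)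
  rw [e5]
  exact ⟨hu1, hu2⟩

/-! ### Spherical means of the weight and measurable profiles. -/

/-- Projection of the line to `[0, 1]`. -/
def clamp (r : ℝ) : ℝ := max 0 (min r 1)

lemma continuous_clamp : Continuous clamp := by unfold clamp; fun_prop
lemma clamp_mem (r : ℝ) : clamp r ∈ Icc (0 : ℝ) 1 := by simp [clamp]
lemma clamp_of_mem {r : ℝ} (hr : r ∈ Icc (0 : ℝ) 1) : clamp r = r := by
  simp [clamp, hr.1, hr.2]

/-- The mean of `V` on the sphere of radius `r`. -/
noncomputable def sphMean {n : ℕ} (V : E n → ℝ) (r : ℝ) : ℝ :=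
  (∫ w, V (polar (w, clamp r)) ∂sphereMeasure n) / (area n).toReal

lemma polar_clamp_mem {n : ℕ} (w : sphere (0 : E n) 1) (r : ℝ) :
    polar (w, clamp r) ∈ closedBall (0 : E n) 1 := by
  have := clamp_mem r
  rw [mem_closedBall_zero_iff, norm_polar, abs_le]
  constructor <;> simp only <;> linarith [this.1, this.2]

lemma area_toReal_pos {n : ℕ} (hn : 1 ≤ n) : 0 < (area n).toReal :=
  ENNReal.toReal_pos (area_ne_zero hn) (area_ne_top n)

lemma continuous_polar_clamp {n : ℕ} {V : E n → ℝ} (hV : ContinuousOn V (closedBall 0 1)) :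
    Continuous fun p : ℝ × sphere (0 : E n) 1 => V (polar (p.2, clamp p.1)) := by
  refine hV.comp_continuous ?_ fun p => polar_clamp_mem _ _
  exact continuous_polar.comp (continuous_snd.prodMk (continuous_clamp.comp continuous_fst))

/-- Clamping the radius keeps the argument in the closed ball, so the mean is continuous on the
whole line. This lets the profile be constructed on all of `ℝ`, with two-sided derivatives at `0`
and `1`. -/
lemma continuous_sphMean {n : ℕ} {V : E n → ℝ} (hV : ContinuousOn V (closedBall 0 1)) :
    Continuous (sphMean V) := by
  have h := continuous_parametric_integral_of_continuous (μ := sphereMeasure n)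
    (f := fun (r : ℝ) (w : sphere (0 : E n) 1) => V (polar (w, clamp r)))
    (continuous_polar_clamp hV) (isCompact_univ)
  simp only [Measure.restrict_univ] at h
  exact h.div_const _

lemma sphMean_pos {n : ℕ} (hn : 1 ≤ n) {V : E n → ℝ} (hV : ContinuousOn V (closedBall 0 1))
    (hpos : ∀ x ∈ closedBall (0 : E n) 1, 0 < V x) (r : ℝ) : 0 < sphMean V r := by
  have hc : Continuous fun w : sphere (0 : E n) 1 => V (polar (w, clamp r)) :=
    (continuous_polar_clamp hV).comp (continuous_const.prodMk continuous_id)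
  refine div_pos ?_ (area_toReal_pos hn)
  have hint : Integrable (fun w : sphere (0 : E n) 1 => V (polar (w, clamp r))) (sphereMeasure n) :=
    hc.integrable_of_hasCompactSupport (HasCompactSupport.of_compactSpace _)
  rw [integral_pos_iff_support_of_nonneg (fun w => (hpos _ (polar_clamp_mem w r)).le) hint]
  have : Function.support (fun w : sphere (0 : E n) 1 => V (polar (w, clamp r))) = univ := by
    ext w; simpa using (hpos _ (polar_clamp_mem w r)).ne'
  rw [this]
  exact (area_ne_zero hn).bot_lt

lemma integral_comp_norm {n : ℕ} (hn : 1 ≤ n) {h : ℝ → ℝ}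
    (hh : AEStronglyMeasurable h (radMeasure n)) :
    ∫ x in ball (0 : E n) 1, h ‖x‖ = (area n).toReal * ∫ r, h r ∂radMeasure n := by
  have h1 : AEStronglyMeasurable h ((ballMeasure n).map norm) := by
    rw [map_norm_ballMeasure hn]; exact hh.smul_measure _
  rw [← integral_map measurable_norm.aemeasurable h1, map_norm_ballMeasure hn,
    integral_smul_measure, smul_eq_mul]

/-- Against radial functions, `V` may be replaced by its spherical mean. -/
lemma integral_mul_radial {n : ℕ} (hn : 1 ≤ n) {V : E n → ℝ}
    (hV : ContinuousOn V (closedBall 0 1)) {h : ℝ → ℝ} (hh : Integrable h (radMeasure n)) :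
    ∫ x in ball (0 : E n) 1, V x * h ‖x‖ = ∫ x in ball (0 : E n) 1, sphMean V ‖x‖ * h ‖x‖ := by
  have hint : Integrable (fun x : E n => h ‖x‖) (ballMeasure n) := by
    have : Integrable h ((ballMeasure n).map norm) := by
      rw [map_norm_ballMeasure hn]; exact hh.smul_measure (area_ne_top n)
    exact this.comp_measurable measurable_norm
  obtain ⟨C, hC⟩ := (isCompact_closedBall (0 : E n) 1).exists_bound_of_continuousOn hV
  have hVh : Integrable (fun x => V x * h ‖x‖) (ballMeasure n) := by
    refine hint.bdd_mul (c := C)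
      ((hV.mono ball_subset_closedBall).aestronglyMeasurable measurableSet_ball) ?_
    filter_upwards [ae_restrict_mem measurableSet_ball] with x hx
    exact hC x (ball_subset_closedBall hx)
  have hm := (continuous_sphMean hV).aestronglyMeasurable.mul hh.1
  rw [integral_ball_polar_symm hn hVh,
    integral_comp_norm (h := fun r => sphMean V r * h r) hn hm, ← integral_const_mul]
  refine integral_congr_ae ?_
  filter_upwards [ae_radMeasure_mem n] with r hr
  have e : ∀ w : sphere (0 : E n) 1, ‖polar (w, r)‖ = r := fun w => by
    rw [norm_polar]; exact abs_of_pos hr.1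
  simp only [e, sphMean, clamp_of_mem (Ioo_subset_Icc_self hr)]
  rw [integral_mul_const]
  have := (area_toReal_pos hn).ne'
  field_simp

/-- A radial element of `H¹₀` has a measurable profile. -/
lemma exists_memLp_profile {n : ℕ} (hn : 1 ≤ n) {φ : H10 n} (hφ : φ ∈ radialH10 n) :
    ∃ g : ℝ → ℝ, MemLp g 2 (radMeasure n) ∧ fn φ =ᵐ[ballMeasure n] fun x => g ‖x‖ := by
  obtain ⟨g₀, hg₀⟩ := hφ
  have h1 := (measurePreserving_polar hn).quasiMeasurePreserving.ae hg₀
  have h2 := Measure.ae_ae_of_ae_prod h1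
  have hne : sphereMeasure n ≠ 0 := by
    intro h
    apply area_ne_zero hn
    simp [area, h]
  have : (ae (sphereMeasure n)).NeBot := ae_neBot.2 hne
  obtain ⟨w, hw⟩ := h2.exists
  -- The profile `g₀` need not be measurable. The restriction of the measurable function `fn φ` to a
  -- generic ray is, and it agrees with `g₀` almost everywhere.
  let g : ℝ → ℝ := fun r => fn φ (polar (w, r))
  have hgm : StronglyMeasurable g := by
    have : StronglyMeasurable (fn φ) := Lp.stronglyMeasurable _
    exact this.comp_measurable (continuous_polar.comp (continuous_const.prodMk
      continuous_id)).measurable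
  have hg : fn φ =ᵐ[ballMeasure n] fun x => g ‖x‖ := by
    have h3 : ∀ᵐ r ∂radMeasure n, g r = g₀ r := by
      filter_upwards [hw, ae_radMeasure_mem n] with r h4 h5
      rw [norm_polar] at h4
      simpa [abs_of_pos h5.1] using h4
    filter_upwards [hg₀, ae_norm_iff hn h3] with x h4 h5
    rw [h4, h5]
  refine ⟨g, ⟨hgm.aestronglyMeasurable, ?_⟩, hg⟩
  have h6 := eLpNorm_comp_norm hn (hgm.aestronglyMeasurable (μ := radMeasure n))
  rw [← eLpNorm_congr_ae hg] at h6
  by_contra hcon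
  rw [not_lt_top_iff] at hcon
  rw [hcon, ENNReal.mul_top (by simp [area_ne_zero hn, area_ne_top n])] at h6
  exact (memLp_fn φ).2.ne h6

lemma memLp_mul_continuous {n : ℕ} {A h : ℝ → ℝ} (hA : Continuous A)
    (hh : MemLp h 2 (radMeasure n)) : MemLp (fun r => A r * h r) 2 (radMeasure n) := by
  obtain ⟨C, hC⟩ := (isCompact_Icc (a := (0 : ℝ)) (b := 1)).exists_bound_of_continuousOn
    hA.continuousOn
  refine MemLp.of_le_mul (c := C) hh (hA.aestronglyMeasurable.mul hh.1) ?_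
  filter_upwards [ae_radMeasure_mem n] with r hr
  rw [norm_mul]
  gcongr
  exact hC r (Ioo_subset_Icc_self hr)

/-! ### The eigenvalue equation as a fixed-point equation for the source. -/

section Eigenfunction

variable {n : ℕ} {V : E n → ℝ} {lam σ : ℝ} {φ : H10 n}

lemma IsEigenfunction.weak (hφ : IsEigenfunction V lam σ φ) (η : H10 n) :
    ∫ x in ball (0 : E n) 1, ⟪grad φ x, grad η x⟫_ℝ
      = (lam + σ) * ∫ x in ball (0 : E n) 1, V x * osc V (fn φ) x * fn η x := by
  linarith [hφ.2 η]

/-- The right hand side of the radial equation. -/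
noncomputable def source (V : E n → ℝ) (m a : ℝ) (g : ℝ → ℝ) (r : ℝ) : ℝ :=
  m * (sphMean V r * (g r - a))

lemma memLp_source (hV : ContinuousOn V (closedBall 0 1)) (m a : ℝ) {g : ℝ → ℝ}
    (hg : MemLp g 2 (radMeasure n)) : MemLp (source V m a g) 2 (radMeasure n) :=
  (memLp_mul_continuous (continuous_sphMean hV) (hg.sub (memLp_const a))).const_mul m

/-- Only radial test functions are used, so `V` enters through its spherical mean and no symmetry of
`V` is required. The source `F` is expressed through the solution that it generates, which is the
form that the bootstrap needs. -/
theorem exists_weak_profile (hn : 2 ≤ n) (hV : ContinuousOn V (closedBall 0 1))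
    (hφ : IsEigenfunction V lam σ φ) (hrad : φ ∈ radialH10 n) :
    ∃ F : ℝ → ℝ, MemLp F 2 (radMeasure n) ∧
      F =ᵐ[radMeasure n] source V (lam + σ) (avg V (fn φ)) (prim (radSlope n F)) ∧
      (fn φ =ᵐ[ballMeasure n] fun x => prim (radSlope n F) ‖x‖) ∧
      grad φ =ᵐ[ballMeasure n] radField n (radSlope n F) := by
  have hn1 : 1 ≤ n := by omega
  obtain ⟨g, hg, hgφ⟩ := exists_memLp_profile hn1 hrad
  set a := avg V (fn φ)
  have hF := memLp_source hV (lam + σ) a hg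
  have key := radial_weak_unique hn hF hg hgφ (fun η d hd hη => by
    rw [hφ.weak η]
    have hi : Integrable (fun r => (g r - a) * d r) (radMeasure n) :=
      (hg.sub (memLp_const a)).integrable_mul hd
    have e1 : ∫ x in ball (0 : E n) 1, V x * osc V (fn φ) x * fn η x
        = ∫ x in ball (0 : E n) 1, V x * ((g ‖x‖ - a) * d ‖x‖) := by
      refine integral_congr_ae ?_
      filter_upwards [hgφ, hη] with x h1 h2
      simp only [osc, h1, h2]; ring
    rw [e1, integral_mul_radial (h := fun r => (g r - a) * d r) hn1 hV hi, ← integral_const_mul]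
    refine integral_congr_ae ?_
    filter_upwards [hη] with x h2
    simp only [source, h2]; ring)
  refine ⟨_, hF, ?_, key⟩
  have h1 : g =ᵐ[radMeasure n] prim (radSlope n (source V (lam + σ) a g)) := by
    refine ae_of_ae_norm hn1 hg.1 (memLp_prim (memLp_slope hn1 hF)).1 ?_
    filter_upwards [hgφ, key.1] with x h1 h2
    rw [← h1, h2]
  filter_upwards [h1] with r hr
  rw [source, source, ← hr]

end Eigenfunction

/-! ### Regularity at the origin. -/

lemma abs_prim_le {k : ℝ → ℝ} {C : ℝ} {m : ℕ}
    (hk : ∀ t ∈ Ioc (0 : ℝ) 1, |k t| ≤ C / t ^ m) (hC : 0 ≤ C) :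
    ∀ r ∈ Ioc (0 : ℝ) 1, |prim k r| ≤ C / r ^ m := by
  intro r hr
  have h : ∀ t ∈ uIoc r 1, ‖k t‖ ≤ C / r ^ m := by
    intro t ht
    rw [uIoc_of_le hr.2] at ht
    refine (hk t ⟨hr.1.trans ht.1, ht.2⟩).trans ?_
    have := hr.1
    gcongr
    exact ht.1.le
  have h2 := intervalIntegral.norm_integral_le_of_norm_le_const h
  rw [prim, abs_neg]
  refine h2.trans ?_
  refine mul_le_of_le_one_right (div_nonneg hC (pow_nonneg hr.1.le _)) ?_
  rw [abs_of_nonneg (by linarith [hr.2])]; linarith [hr.1]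

lemma abs_flux_le {n : ℕ} {F : ℝ → ℝ} {C : ℝ} {m j : ℕ} (hj : n - 1 = m + j) (hC : 0 ≤ C)
    (hF : ∀ᵐ t ∂radMeasure n, |F t| ≤ C / t ^ m) :
    ∀ r ∈ Ioc (0 : ℝ) 1, |flux n F r| ≤ C * r ^ (j + 1) := by
  intro r hr
  have h : ∀ᵐ t, t ∈ uIoc 0 r → ‖t ^ (n - 1) * F t‖ ≤ C * r ^ j := by
    rw [ae_radMeasure_iff, ae_restrict_iff' measurableSet_Ioo] at hF
    have h1 : ∀ᵐ t : ℝ, t ≠ 1 := by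
      simp [ae_iff, measure_singleton]
    filter_upwards [hF, h1] with t h2 h3 h4
    rw [uIoc_of_le hr.1.le] at h4
    have ht : 0 < t := h4.1
    have h5 := h2 ⟨ht, lt_of_le_of_ne (h4.2.trans hr.2) h3⟩
    rw [norm_mul, Real.norm_eq_abs, Real.norm_eq_abs, abs_of_pos (pow_pos ht _), hj, pow_add]
    calc t ^ m * t ^ j * |F t| ≤ t ^ m * t ^ j * (C / t ^ m) := by gcongr
      _ = C * t ^ j := by field_simp
      _ ≤ C * r ^ j := by gcongr; exact h4.2
  have h2 := intervalIntegral.norm_integral_le_of_norm_le_const_ae h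
  rw [sub_zero, abs_of_pos hr.1] at h2
  rw [pow_succ, ← mul_assoc]
  exact h2

/-- The bootstrap: the singularity at the origin is removable. -/
theorem exists_bound_slope {n : ℕ} {F B : ℝ → ℝ} {a : ℝ}
    (hF : Integrable F (radMeasure n)) (hB : Continuous B)
    (h : ∀ᵐ r ∂radMeasure n, F r = B r * (prim (radSlope n F) r - a)) :
    ∃ C, 0 ≤ C ∧ ∀ r ∈ Ioc (0 : ℝ) 1, |radSlope n F r| ≤ C * r := by
  obtain ⟨M, hM⟩ := (isCompact_Icc (a := (0 : ℝ)) (b := 1)).exists_bound_of_continuousOn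
    hB.continuousOn
  have hM0 : 0 ≤ M := (norm_nonneg _).trans (hM 0 (by simp))
  -- A solution of size `r ^ (-m)` has a source of the same size, and integrating against `t ^ (n -
  -- 1)` gives a flux of size `r ^ (n - m)`, that is, `r ^ (j + 1)`.
  have hstep : ∀ m j : ℕ, n - 1 = m + j → (∃ C, 0 ≤ C ∧ ∀ r ∈ Ioc (0 : ℝ) 1,
      |prim (radSlope n F) r| ≤ C / r ^ m) →
      ∃ C, 0 ≤ C ∧ ∀ r ∈ Ioc (0 : ℝ) 1, |flux n F r| ≤ C * r ^ (j + 1) := by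
    rintro m j hj ⟨C, hC0, hC⟩
    refine ⟨M * (C + |a|), by positivity, abs_flux_le hj (by positivity) ?_⟩
    filter_upwards [h, ae_radMeasure_mem n] with t h1 h2
    have ht : 0 < t := h2.1
    rw [h1, abs_mul, mul_div_assoc]
    have h3 := hC t (Ioo_subset_Ioc_self h2)
    have h4 : |a| ≤ |a| / t ^ m := by
      rw [le_div_iff₀ (by positivity)]
      exact mul_le_of_le_one_right (abs_nonneg _) (pow_le_one₀ ht.le h2.2.le)
    gcongr
    · exact hM t (Ioo_subset_Icc_self h2)
    · rw [add_div]
      exact (abs_sub _ _).trans (add_le_add h3 h4)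
  -- The induction starts at `m = n - 1`, where boundedness of the flux suffices. Each round lowers
  -- the order of the singularity by one, down to `m = 0`.
  have hall : ∀ j m : ℕ, n - 1 = m + j → ∃ C, 0 ≤ C ∧ ∀ r ∈ Ioc (0 : ℝ) 1,
      |prim (radSlope n F) r| ≤ C / r ^ m := by
    intro j
    induction j with
    | zero =>
      intro m hm
      obtain ⟨C, hC⟩ := (isCompact_Icc (a := (0 : ℝ)) (b := 1)).exists_bound_of_continuousOn
        (continuousOn_flux hF)
      have hC0 : 0 ≤ C := (norm_nonneg _).trans (hC 0 (by simp))
      refine ⟨C, hC0, abs_prim_le (fun t ht => ?_) hC0⟩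
      have := ht.1
      rw [radSlope, abs_neg, abs_div, abs_of_pos (pow_pos ht.1 _), hm, add_zero]
      gcongr
      exact hC t (Ioc_subset_Icc_self ht)
    | succ j ih =>
      intro m hm
      obtain ⟨C, hC0, hC⟩ := hstep (m + 1) j (by omega) (ih (m + 1) (by omega))
      refine ⟨C, hC0, abs_prim_le (fun t ht => ?_) hC0⟩
      have := ht.1
      rw [radSlope, abs_neg, abs_div, abs_of_pos (pow_pos ht.1 _), hm, pow_add, div_le_div_iff₀
        (by positivity) (by positivity)]
      calc |flux n F t| * t ^ m ≤ C * t ^ (j + 1) * t ^ m := by gcongr; exact hC t ht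
        _ = _ := by ring
  obtain ⟨C, hC0, hC⟩ := hstep 0 (n - 1) (by omega) (hall (n - 1) 0 (by omega))
  refine ⟨C, hC0, fun r hr => ?_⟩
  have := hr.1
  rw [radSlope, abs_neg, abs_div, abs_of_pos (pow_pos hr.1 _), div_le_iff₀ (by positivity)]
  calc |flux n F r| ≤ C * r ^ (n - 1 + 1) := hC r hr
    _ = _ := by ring

/-- The mean `∫₀¹ sⁿ⁻¹ F(rs) ds`. -/
noncomputable def dilMean (n : ℕ) (F : ℝ → ℝ) (r : ℝ) : ℝ :=
  ∫ s in (0 : ℝ)..1, s ^ (n - 1) * F (r * s)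

lemma continuous_dilMean {n : ℕ} {F : ℝ → ℝ} (hF : Continuous F) : Continuous (dilMean n F) := by
  refine intervalIntegral.continuous_parametric_intervalIntegral_of_continuous' ?_ 0 1
  have : Continuous fun p : ℝ × ℝ => p.2 ^ (n - 1) * F (p.1 * p.2) := by fun_prop
  exact this

lemma dilMean_zero {n : ℕ} (hn : 1 ≤ n) (F : ℝ → ℝ) : dilMean n F 0 = F 0 / n := by
  simp only [dilMean, zero_mul, intervalIntegral.integral_mul_const, integral_pow]
  have : ((n - 1 : ℕ) : ℝ) + 1 = n := by exact_mod_cast Nat.sub_add_cancel hn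
  rw [this, Nat.sub_add_cancel hn]
  simp [show n ≠ 0 by omega]
  ring

lemma mul_dilMean {n : ℕ} {F : ℝ → ℝ} {r : ℝ} (hr : r ≠ 0) :
    r * dilMean n F r = flux n F r / r ^ (n - 1) := by
  have h := intervalIntegral.integral_comp_mul_left (a := 0) (b := 1)
    (fun t => t ^ (n - 1) * F t) hr
  simp only [mul_zero, mul_one, smul_eq_mul] at h
  have h2 : ∫ s in (0 : ℝ)..1, (r * s) ^ (n - 1) * F (r * s) = r ^ (n - 1) * dilMean n F r := by
    rw [dilMean, ← intervalIntegral.integral_const_mul]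
    congr 1
    ext s
    ring
  rw [h2] at h
  rw [flux, eq_div_iff (pow_ne_zero _ hr)]
  calc r * dilMean n F r * r ^ (n - 1) = r * (r ^ (n - 1) * dilMean n F r) := by ring
    _ = _ := by rw [h, ← mul_assoc, mul_inv_cancel₀ hr, one_mul]

/-- Substituting `t = r s` turns the singular quotient `flux / r ^ (n - 1)` into `r` times a
continuous mean. Away from `0` this is the quotient rule. At `0` the difference quotient is the mean
itself, with limit `F 0 / n`, which agrees with the general formula. -/
lemma hasDerivAt_mul_dilMean {n : ℕ} (hn : 1 ≤ n) {F : ℝ → ℝ} (hF : Continuous F) (r : ℝ) :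
    HasDerivAt (fun r => r * dilMean n F r) (F r - (n - 1) * dilMean n F r) r := by
  have hH := continuous_dilMean (n := n) hF
  by_cases hr : r = 0
  · subst hr
    have h1 : F 0 - (n - 1) * dilMean n F 0 = dilMean n F 0 := by
      rw [dilMean_zero hn]
      have : (n : ℝ) ≠ 0 := by exact_mod_cast (show n ≠ 0 by omega)
      field_simp; ring
    rw [h1, hasDerivAt_iff_tendsto_slope]
    have h2 : Filter.Tendsto (dilMean n F) (nhdsWithin 0 {0}ᶜ) (nhds (dilMean n F 0)) :=
      hH.continuousAt.tendsto.mono_left nhdsWithin_le_nhds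
    refine h2.congr' ?_
    filter_upwards [self_mem_nhdsWithin] with t ht
    have : t ≠ 0 := ht
    simp [slope_def_field, this]
  · have hfl : HasDerivAt (flux n F) (r ^ (n - 1) * F r) r := by
      have hc : Continuous fun t => t ^ (n - 1) * F t := by fun_prop
      exact intervalIntegral.integral_hasDerivAt_right (hc.intervalIntegrable _ _)
        hc.stronglyMeasurable.stronglyMeasurableAtFilter hc.continuousAt
    have h1 := hfl.div (hasDerivAt_pow (n - 1) r) (pow_ne_zero _ hr)
    have h2 : (fun r => r * dilMean n F r) =ᶠ[nhds r] flux n F / fun r => r ^ (n - 1) := by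
      filter_upwards [isOpen_ne.mem_nhds hr] with t ht
      exact mul_dilMean ht
    refine (h1.congr_of_eventuallyEq h2).congr_deriv ?_
    have h3 : flux n F r = r * dilMean n F r * r ^ (n - 1) := by
      rw [mul_dilMean hr, div_mul_cancel₀ _ (pow_ne_zero _ hr)]
    rw [h3, Nat.cast_sub hn, Nat.cast_one]
    rcases Nat.eq_or_lt_of_le hn with h4 | h4
    · subst h4; simp
    · obtain ⟨m, rfl⟩ : ∃ m, n = m + 2 := ⟨n - 2, by omega⟩
      simp only [show m + 2 - 1 = m + 1 by omega, Nat.add_sub_cancel]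
      push_cast
      field_simp
      ring

/-! ### The `C²` profile, its boundary conditions and the sign of `λ + σ`. -/

/-- `g` is a `C²` profile of `φ`, solving the radial form of `-Δφ = m V (φ - a)`. -/
structure IsProfile {n : ℕ} (V : E n → ℝ) (m a : ℝ) (φ : H10 n) (g g₁ g₂ : ℝ → ℝ) : Prop where
  deriv_one : ∀ r, HasDerivAt g (g₁ r) r
  deriv_two : ∀ r, HasDerivAt g₁ (g₂ r) r
  cont_two : Continuous g₂
  fn_eq : fn φ =ᵐ[ballMeasure n] fun x => g ‖x‖
  grad_eq : grad φ =ᵐ[ballMeasure n] radField n g₁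
  one : g 1 = 0
  deriv_zero : g₁ 0 = 0
  deriv_at_one : g₁ 1 = 0
  ode : ∀ r ∈ Ioc (0 : ℝ) 1, g₂ r = -(m * (sphMean V r * (g r - a))) - (n - 1) * (g₁ r / r)
  ode_zero : n * g₂ 0 = -(m * (sphMean V 0 * (g 0 - a)))

lemma flux_congr {n : ℕ} {F F' : ℝ → ℝ} (h : F =ᵐ[radMeasure n] F') {r : ℝ}
    (hr : r ∈ Icc (0 : ℝ) 1) : flux n F r = flux n F' r := by
  rw [flux, flux, intervalIntegral.integral_of_le hr.1, intervalIntegral.integral_of_le hr.1,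
    integral_Ioc_eq_integral_Ioo, integral_Ioc_eq_integral_Ioo]
  refine integral_congr_ae ?_
  have h1 := ae_radMeasure_iff.1 h
  have h2 : ∀ᵐ t ∂volume.restrict (Ioo 0 r), F t = F' t :=
    ae_mono (Measure.restrict_mono_set _ (Ioo_subset_Ioo_right hr.2)) h1
  filter_upwards [h2] with t ht
  rw [ht]

lemma prim_congr {k k' : ℝ → ℝ} (h : ∀ r ∈ Ioc (0 : ℝ) 1, k r = k' r) {r : ℝ}
    (hr : r ∈ Icc (0 : ℝ) 1) : prim k r = prim k' r := by
  rw [prim, prim]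
  congr 1
  refine intervalIntegral.integral_congr_ae (.of_forall fun t ht => ?_)
  rw [uIoc_of_le hr.2] at ht
  exact h t ⟨hr.1.trans_lt ht.1, ht.2⟩

lemma integral_V_pos {n : ℕ} {V : E n → ℝ} (hV : ContinuousOn V (closedBall 0 1))
    (hpos : ∀ x ∈ closedBall (0 : E n) 1, 0 < V x) : 0 < ∫ x in ball (0 : E n) 1, V x := by
  refine (setIntegral_pos_iff_support_of_nonneg_ae ?_ ?_).2 ?_
  · filter_upwards [ae_restrict_mem measurableSet_ball] with x hx
    exact (hpos x (ball_subset_closedBall hx)).le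
  · exact (memLp_ball_of_continuous hV 1).integrable le_rfl
  · have : Function.support V ∩ ball (0 : E n) 1 = ball 0 1 :=
      inter_eq_right.2 fun x hx => (hpos x (ball_subset_closedBall hx)).ne'
    rw [this]
    exact measure_ball_pos _ _ one_pos

lemma memLp_top_V {n : ℕ} {V : E n → ℝ} (hV : ContinuousOn V (closedBall 0 1)) :
    MemLp V ⊤ (ballMeasure n) := memLp_ball_of_continuous hV ⊤

lemma integrable_V_mul {n : ℕ} {V : E n → ℝ} (hV : ContinuousOn V (closedBall 0 1))
    {u : E n → ℝ} (hu : Integrable u (ballMeasure n)) :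
    Integrable (fun x => V x * u x) (ballMeasure n) := hu.mul_of_top_right (memLp_top_V hV)

lemma integral_osc {n : ℕ} {V : E n → ℝ} (hV : ContinuousOn V (closedBall 0 1))
    (hpos : ∀ x ∈ closedBall (0 : E n) 1, 0 < V x) {u : E n → ℝ}
    (hu : Integrable u (ballMeasure n)) : ∫ x in ball (0 : E n) 1, V x * osc V u x = 0 := by
  have hVi : Integrable V (ballMeasure n) := (memLp_ball_of_continuous hV 1).integrable le_rfl
  simp only [osc, mul_sub]
  rw [integral_sub (integrable_V_mul hV hu) (hVi.mul_const _), integral_mul_const, avg,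
    mul_div_cancel₀ _ (integral_V_pos hV hpos).ne', sub_self]

lemma integrable_fn {n : ℕ} (φ : H10 n) : Integrable (fn φ) (ballMeasure n) :=
  (memLp_fn φ).integrable (by norm_num)

theorem exists_profile {n : ℕ} (hn : 2 ≤ n) {V : E n → ℝ} {lam σ : ℝ} {φ : H10 n}
    (hV : ContinuousOn V (closedBall 0 1)) (hpos : ∀ x ∈ closedBall (0 : E n) 1, 0 < V x)
    (hφ : IsEigenfunction V lam σ φ) (hrad : φ ∈ radialH10 n) :
    ∃ g g₁ g₂ : ℝ → ℝ, IsProfile V (lam + σ) (avg V (fn φ)) φ g g₁ g₂ := by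
  have hn1 : 1 ≤ n := by omega
  obtain ⟨F, hF, hFe, h1, h2⟩ := exists_weak_profile hn hV hφ hrad
  set a := avg V (fn φ)
  set m := lam + σ
  have hFi : Integrable F (radMeasure n) := hF.integrable (by norm_num)
  obtain ⟨C, hC0, hC⟩ := exists_bound_slope (B := fun r => m * sphMean V r) (a := a) hFi
    (continuous_const.mul (continuous_sphMean hV)) (by
      filter_upwards [hFe] with r hr
      rw [hr, source]; ring)
  -- Truncation discards the values of `radSlope` outside `(0, 1]`. The bound just obtained makes
  -- `k` integrable on the line, so its primitive is continuous everywhere, including at the origin.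
  let k : ℝ → ℝ := (Ioc (0 : ℝ) 1).indicator (radSlope n F)
  have hk : ∀ r ∈ Ioc (0 : ℝ) 1, radSlope n F r = k r := fun r hr => (indicator_of_mem hr _).symm
  have hki : Integrable k volume := by
    rw [integrable_indicator_iff measurableSet_Ioc]
    refine IntegrableOn.of_bound (by simp) ((continuousOn_slope hFi).aestronglyMeasurable
      measurableSet_Ioc) C ?_
    filter_upwards [ae_restrict_mem measurableSet_Ioc] with r hr
    exact (hC r hr).trans (mul_le_of_le_one_right hC0 hr.2)
  have hG : Continuous (prim k) := by
    have : Continuous fun r => ∫ s in (1 : ℝ)..r, k s :=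
      intervalIntegral.continuous_primitive (fun _ _ => hki.intervalIntegrable) 1
    refine this.congr fun r => ?_
    rw [prim, intervalIntegral.integral_symm]
  let F₁ := source V m a (prim k)
  have hF₁ : Continuous F₁ := by
    have := continuous_sphMean hV
    change Continuous fun r => m * (sphMean V r * (prim k r - a))
    fun_prop
  have hFF : F =ᵐ[radMeasure n] F₁ := by
    filter_upwards [hFe, ae_radMeasure_mem n] with r hr hr'
    rw [hr]
    simp only [F₁, source]
    rw [prim_congr hk (Ioo_subset_Icc_self hr')]
  let g₁ : ℝ → ℝ := fun r => -(r * dilMean n F₁ r)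
  have hg₁c : Continuous g₁ := by
    have := continuous_dilMean (n := n) hF₁
    fun_prop
  have hsl : ∀ r ∈ Ioc (0 : ℝ) 1, radSlope n F r = g₁ r := by
    intro r hr
    simp only [g₁]
    rw [radSlope, flux_congr hFF (Ioc_subset_Icc_self hr), mul_dilMean hr.1.ne']
  have hpr : ∀ r ∈ Icc (0 : ℝ) 1, prim k r = prim g₁ r := by
    intro r hr
    rw [← prim_congr hk hr, prim_congr hsl hr]
  have hode : ∀ r ∈ Icc (0 : ℝ) 1, F₁ r = m * (sphMean V r * (prim g₁ r - a)) := by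
    intro r hr
    rw [← hpr r hr]; rfl
  refine ⟨prim g₁, g₁, fun r => -(F₁ r - (n - 1) * dilMean n F₁ r), ?_⟩
  constructor
  · exact hasDerivAt_prim hg₁c
  · exact fun r => (hasDerivAt_mul_dilMean hn1 hF₁ r).neg
  · have := continuous_dilMean (n := n) hF₁
    fun_prop
  · filter_upwards [h1, ae_norm_iff hn1 (ae_radMeasure_mem n)] with x h3 h4
    rw [h3, prim_congr hsl (Ioo_subset_Icc_self h4)]
  · filter_upwards [h2, ae_norm_iff hn1 (ae_radMeasure_mem n)] with x h3 h4
    rw [h3, radField, radField, hsl _ (Ioo_subset_Ioc_self h4)]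
  · simp [prim]
  · simp [g₁]
  -- The extra boundary condition `g'(1) = 0`: up to sign, `g₁ 1` is the total flux of the source, a
  -- multiple of `∫ V [φ] = 0`.
  · have e1 := integral_osc hV hpos (integrable_fn φ)
    have hgi : MemLp (fun r => prim k r - a) 2 (radMeasure n) := by
      refine MemLp.sub ?_ (memLp_const a)
      refine (memLp_prim (memLp_slope hn1 hF)).ae_eq ?_
      filter_upwards [ae_radMeasure_mem n] with r hr
      exact prim_congr hk (Ioo_subset_Icc_self hr)
    have e2 : ∫ x in ball (0 : E n) 1, V x * osc V (fn φ) x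
        = ∫ x in ball (0 : E n) 1, V x * (prim k ‖x‖ - a) := by
      refine integral_congr_ae ?_
      filter_upwards [h1, ae_norm_iff hn1 (ae_radMeasure_mem n)] with x h3 h4
      rw [osc, h3, prim_congr hk (Ioo_subset_Icc_self h4)]
    rw [e2, integral_mul_radial (h := fun r => prim k r - a) hn1 hV
      (hgi.integrable (by norm_num)), integral_comp_norm (h := fun r => sphMean V r * (prim k r - a))
      hn1 ((continuous_sphMean hV).aestronglyMeasurable.mul hgi.1)] at e1
    have e3 := (mul_eq_zero.1 e1).resolve_left (area_toReal_pos hn1).ne'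
    have e4 : dilMean n F₁ 1 = m * ∫ r, sphMean V r * (prim k r - a) ∂radMeasure n := by
      rw [← integral_const_mul, integral_radMeasure, dilMean,
        intervalIntegral.integral_of_le zero_le_one, integral_Ioc_eq_integral_Ioo]
      simp only [one_mul]
      rfl
    simp [g₁, e4, e3]
  · intro r hr
    simp only [g₁]
    rw [hode r (Ioc_subset_Icc_self hr)]
    have := hr.1.ne'
    field_simp
    ring
  · rw [dilMean_zero hn1, hode 0 (by simp)]
    have : (n : ℝ) ≠ 0 := by exact_mod_cast (show n ≠ 0 by omega)
    field_simp
    ring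

section

variable {n : ℕ} {V : E n → ℝ} {lam σ : ℝ} {φ : H10 n}

lemma memLp_osc (u : E n → ℝ) (hu : MemLp u 2 (ballMeasure n)) :
    MemLp (osc V u) 2 (ballMeasure n) := hu.sub (memLp_const _)

/-- Since `V [u]` has integral zero, subtracting a constant from `v` changes nothing. -/
lemma integral_osc_mul (hV : ContinuousOn V (closedBall 0 1))
    (hpos : ∀ x ∈ closedBall (0 : E n) 1, 0 < V x) {u v : E n → ℝ}
    (hu : MemLp u 2 (ballMeasure n)) (hv : MemLp v 2 (ballMeasure n)) :
    oscForm V u v = ∫ x in ball (0 : E n) 1, V x * osc V u x * v x := by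
  have h1 := integral_osc hV hpos (hu.integrable (by norm_num))
  have i1 : Integrable (fun x => V x * (osc V u x * v x)) (ballMeasure n) :=
    integrable_V_mul hV ((memLp_osc u hu).integrable_mul hv)
  have i2 : Integrable (fun x => V x * osc V u x * avg V v) (ballMeasure n) :=
    (integrable_V_mul hV ((memLp_osc u hu).integrable (by norm_num))).mul_const _
  have : oscForm V u v = ∫ x in ball (0 : E n) 1,
      (V x * (osc V u x * v x) - V x * osc V u x * avg V v) := by
    rw [oscForm]; congr 1; ext x; simp only [osc]; ring
  rw [this, integral_sub i1 i2, integral_mul_const, h1, zero_mul, sub_zero]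
  congr 1; ext x; ring

/-- Testing the equation with `φ` gives `∫ |∇φ|² = (λ + σ) ∫ V [φ]²`. The left side is positive by
the Poincaré inequality, and the integral on the right is nonnegative. -/
lemma eigenvalue_pos (hn : 2 ≤ n) (hV : ContinuousOn V (closedBall 0 1))
    (hpos : ∀ x ∈ closedBall (0 : E n) 1, 0 < V x) (hφ : IsEigenfunction V lam σ φ) :
    0 < lam + σ := by
  have h1 := hφ.weak φ
  rw [← integral_osc_mul hV hpos (memLp_fn φ) (memLp_fn φ)] at h1
  have h2 : 0 ≤ oscForm V (fn φ) (fn φ) := by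
    refine setIntegral_nonneg measurableSet_ball fun x hx => ?_
    rw [mul_assoc]
    exact mul_nonneg (hpos x (ball_subset_closedBall hx)).le (mul_self_nonneg _)
  have h3 : 0 < ∫ x in ball (0 : E n) 1, ⟪grad φ x, grad φ x⟫_ℝ := by
    have hi := integrable_inner_of_memLp (memLp_grad φ) (memLp_grad φ)
    refine lt_of_le_of_ne (integral_nonneg fun x => real_inner_self_nonneg) fun h => ?_
    have h0 := (integral_eq_zero_iff_of_nonneg (fun x => real_inner_self_nonneg) hi).1 h.symm
    refine hφ.1 (eq_zero_of_grad hn ?_)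
    filter_upwards [h0] with x hx
    simpa using hx
  rw [h1] at h3
  exact pos_of_mul_pos_left h3 h2

end

namespace IsProfile

variable {n : ℕ} {V : E n → ℝ} {m a : ℝ} {φ : H10 n} {g g₁ g₂ : ℝ → ℝ}

lemma continuous (h : IsProfile V m a φ g g₁ g₂) : Continuous g :=
  continuous_iff_continuousAt.2 fun r => (h.deriv_one r).continuousAt

lemma continuous_one (h : IsProfile V m a φ g g₁ g₂) : Continuous g₁ :=
  continuous_iff_continuousAt.2 fun r => (h.deriv_two r).continuousAt

/-- With `a = 0` the ODE is homogeneous, and the data `g(1) = g'(1) = 0` propagate inwards by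
Grönwall, so `φ` would vanish. -/
lemma avg_ne_zero (h : IsProfile V m a φ g g₁ g₂) (hn : 1 ≤ n)
    (hV : ContinuousOn V (closedBall 0 1)) (hφ : φ ≠ 0) : a ≠ 0 := by
  rintro rfl
  obtain ⟨M, hM⟩ := (isCompact_Icc (a := (0 : ℝ)) (b := 1)).exists_bound_of_continuousOn
    (f := fun r => m * sphMean V r) (continuous_const.mul (continuous_sphMean hV)).continuousOn
  have hM0 : 0 ≤ M := (norm_nonneg _).trans (hM 0 (by simp))
  have key : ∀ r ∈ Ioo (0 : ℝ) 1, g r = 0 ∧ g₁ r = 0 := by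
    intro r hr
    have hn0 : (0 : ℝ) ≤ n - 1 := by
      have : (1 : ℝ) ≤ n := by exact_mod_cast hn
      linarith
    have hr0 := hr.1
    have hd : ∀ t, HasDerivAt (fun t : ℝ => 1 - t) (-1) t := fun t => by
      simpa using (hasDerivAt_id t).const_sub 1
    have hy : ∀ t, HasDerivAt (fun t => (g (1 - t), g₁ (1 - t)))
        (-(g₁ (1 - t)), -(g₂ (1 - t))) t := by
      intro t
      have h1 := (h.deriv_one (1 - t)).comp t (hd t)
      have h2 := (h.deriv_two (1 - t)).comp t (hd t)
      simpa [Function.comp_def] using h1.prodMk h2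
    -- The variable `t = 1 - s` runs inwards from the boundary. On `[r, 1]` the singular coefficient
    -- is at most `(n - 1) / r`, `M` bounds the potential, and the summand `1` covers the first
    -- component.
    have := eq_zero_of_abs_deriv_le_mul_abs_self_of_eq_zero_right (a := 0) (b := 1 - r)
      (K := M + (n - 1) / r + 1)
      (f := fun t => (g (1 - t), g₁ (1 - t))) (f' := fun t => (-(g₁ (1 - t)), -(g₂ (1 - t))))
      (fun t _ => (hy t).continuousAt.continuousWithinAt)
      (fun t _ => (hy t).hasDerivWithinAt) (by simp [h.one, h.deriv_at_one]) ?_ (1 - r)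
      ⟨by linarith [hr.2], le_rfl⟩
    · simpa using this
    · intro t ht
      set s := 1 - t with hs
      have hsr : r ≤ s := by linarith [ht.2]
      have hs1 : s ∈ Ioc (0 : ℝ) 1 := ⟨hr0.trans_le hsr, by linarith [ht.1]⟩
      have hs0 := hs1.1
      simp only [Prod.norm_def, norm_neg, Real.norm_eq_abs]
      set N := max |g s| |g₁ s|
      have hN1 : |g s| ≤ N := le_max_left _ _
      have hN2 : |g₁ s| ≤ N := le_max_right _ _
      have hN0 : 0 ≤ N := (abs_nonneg _).trans hN1
      have h0 : 0 ≤ (n - 1 : ℝ) / r := div_nonneg hn0 hr0.le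
      refine max_le ?_ ?_
      · nlinarith [mul_nonneg hM0 hN0, mul_nonneg h0 hN0]
      · rw [h.ode s hs1]
        have e1 : |m * (sphMean V s * (g s - 0))| ≤ M * N := by
          rw [sub_zero, ← mul_assoc, abs_mul]
          exact mul_le_mul (hM s (Ioc_subset_Icc_self hs1)) hN1 (abs_nonneg _) hM0
        have e2 : |(n - 1 : ℝ) * (g₁ s / s)| ≤ (n - 1) / r * N := by
          rw [abs_mul, abs_div, abs_of_nonneg hn0, abs_of_pos hs0, div_mul_eq_mul_div, mul_div_assoc]
          gcongr
        calc _ ≤ |m * (sphMean V s * (g s - 0))| + |(n - 1 : ℝ) * (g₁ s / s)| := by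
              refine (abs_sub _ _).trans ?_
              rw [abs_neg]
          _ ≤ M * N + (n - 1) / r * N := add_le_add e1 e2
          _ ≤ _ := by nlinarith
  have hae := ae_norm_iff hn (ae_radMeasure_mem n)
  refine hφ (H10_ext (ψ := 0) ?_ ?_)
  · filter_upwards [h.fn_eq, hae, Lp.coeFn_zero ℝ 2 (ballMeasure n)] with x h1 h2 h3
    rw [h1, (key _ h2).1]; exact h3.symm
  · filter_upwards [h.grad_eq, hae, Lp.coeFn_zero (E n) 2 (ballMeasure n)] with x h1 h2 h3
    rw [h1, radField, (key _ h2).2, zero_div, zero_smul]; exact h3.symm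

/-- At a double zero only the constant term `m V a` of the equation survives. At the origin the same
term equals `n g''(0)`. -/
lemma second_pos (h : IsProfile V m a φ g g₁ g₂) (hn : 1 ≤ n)
    (hV : ContinuousOn V (closedBall 0 1)) (hpos : ∀ x ∈ closedBall (0 : E n) 1, 0 < V x)
    (hm : 0 < m) (ha : 0 < a) {r : ℝ} (hr : r ∈ Icc (0 : ℝ) 1) (h0 : g r = 0) (h1 : g₁ r = 0) :
    0 < g₂ r := by
  have hA := sphMean_pos hn hV hpos r
  have hma : 0 < m * (sphMean V r * a) := by positivity
  rcases eq_or_lt_of_le hr.1 with h2 | h2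
  · subst h2
    have h3 := h.ode_zero
    rw [h0] at h3
    have hn0 : (0 : ℝ) < n := by exact_mod_cast hn
    have : 0 < n * g₂ 0 := by rw [h3]; linarith
    exact pos_of_mul_pos_right this hn0.le
  · rw [h.ode r ⟨h2, hr.2⟩, h0, h1]
    simp only [zero_div, mul_zero, sub_zero]
    linarith

end IsProfile

/-! ### Cutting the profile along its zeros. -/

/-- The combination of the indicators of the intervals `(c i, d i)` with coefficients `t`. -/
noncomputable def stepFun {ι : Type*} [Fintype ι] (c d t : ι → ℝ) (r : ℝ) : ℝ :=
  ∑ i, t i * (Ioo (c i) (d i)).indicator 1 r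

section

variable {ι : Type*} [Fintype ι] {c d : ι → ℝ}

lemma measurable_stepFun (t : ι → ℝ) : Measurable (stepFun c d t) := by
  unfold stepFun
  exact Finset.measurable_sum _ fun i _ =>
    (measurable_one.indicator measurableSet_Ioo).const_mul _

lemma abs_stepFun_le (t : ι → ℝ) (r : ℝ) : |stepFun c d t r| ≤ ∑ i, |t i| := by
  refine (Finset.abs_sum_le_sum_abs _ _).trans (Finset.sum_le_sum fun i _ => ?_)
  rw [abs_mul]
  refine mul_le_of_le_one_right (abs_nonneg _) ?_
  by_cases h : r ∈ Ioo (c i) (d i) <;> simp [h]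

lemma stepFun_of_mem (hdis : ∀ i j, i ≠ j → d i ≤ c j ∨ d j ≤ c i) (t : ι → ℝ) {i : ι} {r : ℝ}
    (hr : r ∈ Ioo (c i) (d i)) : stepFun c d t r = t i := by
  rw [stepFun, Finset.sum_eq_single i]
  · simp [hr]
  · intro j _ hj
    have : r ∉ Ioo (c j) (d j) := by
      rintro ⟨h1, h2⟩
      rcases hdis j i hj with h | h <;> linarith [hr.1, hr.2]
    simp [this]
  · simp

lemma stepFun_of_notMem (t : ι → ℝ) {r : ℝ} (hr : ∀ i, r ∉ Ioo (c i) (d i)) :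
    stepFun c d t r = 0 := by
  simp [stepFun, hr]

lemma stepFun_sq (hdis : ∀ i j, i ≠ j → d i ≤ c j ∨ d j ≤ c i) (t : ι → ℝ) (r : ℝ) :
    stepFun c d (fun i => t i ^ 2) r = stepFun c d t r ^ 2 := by
  by_cases h : ∃ i, r ∈ Ioo (c i) (d i)
  · obtain ⟨i, hi⟩ := h
    rw [stepFun_of_mem hdis _ hi, stepFun_of_mem hdis _ hi]
  · push Not at h
    rw [stepFun_of_notMem _ h, stepFun_of_notMem _ h]
    simp

/-- Because `g` vanishes at the ends, `g` times the indicator has no jump there and is a primitive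
of `g₁` times the indicator. No zero is required at `c = 0`, since only radii `r > 0` are
considered; this admits a bump around the origin. -/
lemma prim_indicator {g g₁ : ℝ → ℝ} (hg : ∀ r, HasDerivAt g (g₁ r) r) (hg₁ : Continuous g₁)
    {c d : ℝ} (hcd : c < d) (hd : d ≤ 1) (hgd : g d = 0) (hgc : c = 0 ∨ g c = 0)
    {r : ℝ} (hr : r ∈ Ioc (0 : ℝ) 1) :
    ∫ s in r..1, g₁ s * (Ioo c d).indicator 1 s = -(g r * (Ioo c d).indicator 1 r) := by
  have hint : ∀ a b, ∫ s in a..b, g₁ s = g b - g a := fun a b =>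
    intervalIntegral.integral_eq_sub_of_hasDerivAt (fun x _ => hg x) (hg₁.intervalIntegrable a b)
  have e : ∫ s in r..1, g₁ s * (Ioo c d).indicator 1 s = ∫ s in Ioc r 1 ∩ Ioo c d, g₁ s := by
    rw [intervalIntegral.integral_of_le hr.2, ← setIntegral_indicator measurableSet_Ioo]
    congr 1
    ext s
    by_cases h : s ∈ Ioo c d <;> simp [h]
  rw [e]
  by_cases h1 : d ≤ r
  · have : Ioc r 1 ∩ Ioo c d = ∅ := by
      ext s; simp only [mem_inter_iff, mem_Ioc, mem_Ioo, mem_empty_iff_false, iff_false]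
      rintro ⟨⟨h2, -⟩, -, h3⟩; linarith
    have h2 : r ∉ Ioo c d := fun h => by linarith [h.2]
    simp [this, h2]
  push Not at h1
  by_cases h2 : c < r
  · have : Ioc r 1 ∩ Ioo c d = Ioo r d := by
      ext s; simp only [mem_inter_iff, mem_Ioc, mem_Ioo]
      constructor
      · rintro ⟨⟨h2, -⟩, -, h3⟩; exact ⟨h2, h3⟩
      · rintro ⟨h3, h4⟩; exact ⟨⟨h3, by linarith⟩, by linarith, h4⟩
    have h3 : r ∈ Ioo c d := ⟨h2, h1⟩
    rw [this, ← integral_Ioc_eq_integral_Ioo, ← intervalIntegral.integral_of_le h1.le, hint, hgd]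
    simp [h3]
  · push Not at h2
    have hc0 : 0 < c := hr.1.trans_le h2
    have hgc' : g c = 0 := hgc.resolve_left hc0.ne'
    have h3 : r ∉ Ioo c d := fun h => by linarith [h.1]
    have : Ioc r 1 ∩ Ioo c d = Ioo c d := by
      refine inter_eq_right.2 fun s hs => ⟨by linarith [hs.1], by linarith [hs.2]⟩
    rw [this, ← integral_Ioc_eq_integral_Ioo, ← intervalIntegral.integral_of_le hcd.le, hint,
      hgd, hgc']
    simp [h3]

lemma prim_stepFun {g g₁ : ℝ → ℝ} (hg : ∀ r, HasDerivAt g (g₁ r) r) (hg₁ : Continuous g₁)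
    (hcd : ∀ i, c i < d i) (hd : ∀ i, d i ≤ 1) (hgd : ∀ i, g (d i) = 0)
    (hgc : ∀ i, c i = 0 ∨ g (c i) = 0) (t : ι → ℝ) {r : ℝ} (hr : r ∈ Ioc (0 : ℝ) 1) :
    prim (fun s => g₁ s * stepFun c d t s) r = g r * stepFun c d t r := by
  simp only [prim, stepFun, Finset.mul_sum]
  rw [intervalIntegral.integral_finsetSum]
  · rw [← Finset.sum_neg_distrib]
    refine Finset.sum_congr rfl fun i _ => ?_
    have := prim_indicator hg hg₁ (hcd i) (hd i) (hgd i) (hgc i) hr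
    simp_rw [mul_left_comm _ (t i)]
    rw [intervalIntegral.integral_const_mul, this]
    ring
  · intro i _
    simp_rw [mul_left_comm _ (t i)]
    refine IntervalIntegrable.const_mul ?_ _
    have : IntervalIntegrable ((Ioo (c i) (d i)).indicator g₁) volume r 1 := by
      rw [intervalIntegrable_iff]
      exact (intervalIntegrable_iff.1 (hg₁.intervalIntegrable r 1)).indicator measurableSet_Ioo
    refine this.congr fun s _ => ?_
    by_cases h : s ∈ Ioo (c i) (d i) <;> simp [h]

end

/-! ### The Courant argument for nonnegative bumps. -/

section Courant

variable {n : ℕ} {V : E n → ℝ} {lam σ a : ℝ} {φ : H10 n} {g g₁ g₂ : ℝ → ℝ}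

lemma memLp_mul_stepFun {ι : Type*} [Fintype ι] (c d t : ι → ℝ) {h : ℝ → ℝ} (hh : Continuous h) :
    MemLp (fun s => h s * stepFun c d t s) 2 (radMeasure n) := by
  have h1 : MemLp (stepFun c d t) 2 (radMeasure n) :=
    MemLp.of_bound (measurable_stepFun t).aestronglyMeasurable (∑ i, |t i|)
      (.of_forall fun r => abs_stepFun_le t r)
  exact memLp_mul_continuous hh h1

lemma exists_cutoff (hn : 1 ≤ n) {m : ℝ} (hp : IsProfile V m a φ g g₁ g₂)
    {ι : Type*} [Fintype ι] {c d : ι → ℝ}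
    (hcd : ∀ i, c i < d i) (hd : ∀ i, d i ≤ 1) (hgd : ∀ i, g (d i) = 0)
    (hgc : ∀ i, c i = 0 ∨ g (c i) = 0) (t : ι → ℝ) :
    ∃ η : H10 n, (fn η =ᵐ[ballMeasure n] fun x => g ‖x‖ * stepFun c d t ‖x‖) ∧
      grad η =ᵐ[ballMeasure n] radField n (fun s => g₁ s * stepFun c d t s) := by
  obtain ⟨η, h1, h2⟩ := exists_H10_prim hn (memLp_mul_stepFun (n := n) c d t hp.continuous_one)
  refine ⟨η, ?_, h2⟩
  filter_upwards [h1, ae_norm_iff hn (ae_radMeasure_mem n)] with x h3 h4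
  rw [h3, prim_stepFun hp.deriv_one hp.continuous_one hcd hd hgd hgc t (Ioo_subset_Ioc_self h4)]

lemma inner_radField (k k' : ℝ → ℝ) {x : E n} (hx : x ≠ 0) :
    ⟪radField n k x, radField n k' x⟫_ℝ = k ‖x‖ * k' ‖x‖ := by
  have : ‖x‖ ≠ 0 := by simpa using hx
  simp only [radField, inner_smul_left, inner_smul_right, real_inner_self_eq_norm_sq]
  simp
  field_simp

/-- At most `k` disjoint intervals bounded by zeros carry a nonnegative, nonzero profile. -/
theorem courant (hn : 2 ≤ n) (hV : ContinuousOn V (closedBall 0 1))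
    (hpos : ∀ x ∈ closedBall (0 : E n) 1, 0 < V x) {X : Set (H10 n)} (hX : radialH10 n ⊆ X)
    {k : ℕ} (hk : 1 ≤ k) (hσ : IsKthEigenvalue V lam X k σ) (hφ : IsEigenfunction V lam σ φ)
    (ha : 0 < avg V (fn φ)) (hp : IsProfile V (lam + σ) (avg V (fn φ)) φ g g₁ g₂)
    {c d : Fin (k + 1) → ℝ} (hc0 : ∀ i, 0 ≤ c i) (hcd : ∀ i, c i < d i) (hd : ∀ i, d i ≤ 1)
    (hdis : ∀ i j, i ≠ j → d i ≤ c j ∨ d j ≤ c i) (hgd : ∀ i, g (d i) = 0)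
    (hgc : ∀ i, c i = 0 ∨ g (c i) = 0) (hg0 : ∀ i, ∀ r ∈ Ioo (c i) (d i), 0 ≤ g r)
    (hgp : ∀ i, ∃ r ∈ Ioo (c i) (d i), 0 < g r) : False := by
  have hn1 : 1 ≤ n := by omega
  have hm := eigenvalue_pos hn hV hpos hφ
  obtain ⟨e, he, hσe⟩ := hσ
  -- the constraints
  let w : Fin k → E n → ℝ := fun j => if (j : ℕ) = 0 then fun _ => 1 else osc V (fn (e j))
  have hw : ∀ j, MemLp (w j) 2 (ballMeasure n) := by
    intro j
    by_cases hj : (j : ℕ) = 0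
    · simp only [w, hj, if_true]; exact memLp_const 1
    · simp only [w, hj, if_false]; exact memLp_osc _ (memLp_fn _)
  -- Row `0` encodes mean zero and rows `1, …, k - 1` encode orthogonality to the earlier
  -- minimizers. The minimizers are numbered from `1`, so index `0` is free. With `k` conditions on
  -- `k + 1` coefficients, the kernel is nontrivial.
  let M : Matrix (Fin k) (Fin (k + 1)) ℝ := fun j i =>
    ∫ x in ball (0 : E n) 1, V x * (g ‖x‖ * (Ioo (c i) (d i)).indicator 1 ‖x‖ * w j x)
  have hker : LinearMap.ker M.mulVecLin ≠ ⊥ :=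
    LinearMap.ker_ne_bot_of_finrank_lt (by simp)
  obtain ⟨t, htM, ht0⟩ := (Submodule.ne_bot_iff _).1 hker
  rw [LinearMap.mem_ker, Matrix.mulVecLin_apply] at htM
  obtain ⟨η, hη1, hη2⟩ := exists_cutoff hn1 hp hcd hd hgd hgc t
  -- The squared coefficients are chosen so that `φ ζ = η²` and `∇φ · ∇ζ = |∇η|²`, and so that `ζ`
  -- inherits the sign of the bumps.
  obtain ⟨ζ, hζ1, hζ2⟩ := exists_cutoff hn1 hp hcd hd hgd hgc fun i => t i ^ 2
  have horth : ∀ j, ∫ x in ball (0 : E n) 1, V x * (fn η x * w j x) = 0 := by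
    intro j
    have h1 : ∫ x in ball (0 : E n) 1, V x * (fn η x * w j x)
        = ∑ i, M j i * t i := by
      have h2 : ∀ i, Integrable (fun x => V x * (g ‖x‖ * (Ioo (c i) (d i)).indicator 1 ‖x‖ * w j x)
          * t i) (ballMeasure n) := by
        intro i
        have h3 : MemLp (fun x : E n => g ‖x‖ * (Ioo (c i) (d i)).indicator 1 ‖x‖) 2
            (ballMeasure n) := by
          have := memLp_comp_norm hn1 (memLp_mul_stepFun (n := n) c d (Pi.single i 1) hp.continuous)
          simpa [stepFun, Pi.single_apply] using this
        exact Integrable.mul_const (integrable_V_mul hV (h3.integrable_mul (hw j))) _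
      simp only [M]
      simp_rw [← integral_mul_const]
      rw [← integral_finsetSum _ fun i _ => h2 i]
      refine integral_congr_ae ?_
      filter_upwards [hη1] with x hx
      rw [hx, stepFun, Finset.mul_sum, Finset.sum_mul, Finset.mul_sum]
      refine Finset.sum_congr rfl fun i _ => ?_
      ring
    rw [h1]
    exact congrFun htM j
  have havg : avg V (fn η) = 0 := by
    have := horth ⟨0, hk⟩
    simp only [w, if_true, mul_one] at this
    rw [avg, this, zero_div]
  have hosc : osc V (fn η) = fn η := by
    ext x; simp [osc, havg]
  set Q := oscForm V (fn η) (fn η) with hQ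
  have hQ' : Q = ∫ x in ball (0 : E n) 1, V x * fn ζ x * g ‖x‖ := by
    rw [hQ, oscForm, hosc]
    refine integral_congr_ae ?_
    filter_upwards [hη1, hζ1] with x h1 h2
    rw [h1, h2, stepFun_sq hdis]
    ring
  set P := ∫ x in ball (0 : E n) 1, V x * fn ζ x with hPdef
  have hP : 0 < P := by
    have hP' : P = ∫ x in ball (0 : E n) 1, V x * (g ‖x‖ * stepFun c d t ‖x‖ ^ 2) := by
      refine integral_congr_ae ?_
      filter_upwards [hζ1] with x h1
      rw [h1, stepFun_sq hdis]
    have hnn : ∀ r, 0 ≤ g r * stepFun c d t r ^ 2 := by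
      intro r
      by_cases h : ∃ i, r ∈ Ioo (c i) (d i)
      · obtain ⟨i, hi⟩ := h
        exact mul_nonneg (hg0 i r hi) (sq_nonneg _)
      · push Not at h
        rw [stepFun_of_notMem _ h]; simp
    have hint : Integrable (fun x : E n => V x * (g ‖x‖ * stepFun c d t ‖x‖ ^ 2))
        (ballMeasure n) := by
      refine (integrable_V_mul hV (integrable_fn ζ)).congr ?_
      filter_upwards [hζ1] with x h1
      rw [h1, stepFun_sq hdis]
    rw [hP']
    refine (setIntegral_pos_iff_support_of_nonneg_ae ?_ hint).2 ?_
    · filter_upwards [ae_restrict_mem measurableSet_ball] with x hx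
      exact mul_nonneg (hpos x (ball_subset_closedBall hx)).le (hnn _)
    · obtain ⟨i, hi⟩ : ∃ i, t i ≠ 0 := by
        by_contra hcon
        push Not at hcon
        exact ht0 (funext hcon)
      obtain ⟨r, hr, hgr⟩ := hgp i
      let U : Set (E n) := (fun x : E n => ‖x‖) ⁻¹' (Ioo (c i) (d i) ∩ {s | 0 < g s})
      have hU : IsOpen U :=
        (isOpen_Ioo.inter (isOpen_lt continuous_const hp.continuous)).preimage continuous_norm
      have hUne : U.Nonempty := by
        have : Nonempty (Fin n) := ⟨⟨0, hn1⟩⟩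
        obtain ⟨x, hx⟩ := NormedSpace.sphere_nonempty (x := (0 : E n)) (r := r) |>.2
          ((hc0 i).trans hr.1.le)
        have hx' : ‖x‖ = r := by simpa using hx
        refine ⟨x, ?_⟩
        simp only [U, mem_preimage, hx']
        exact ⟨hr, hgr⟩
      refine (hU.measure_pos volume hUne).trans_le (measure_mono ?_)
      intro x hx
      have hx1 : ‖x‖ ∈ Ioo (c i) (d i) := hx.1
      have hxb : x ∈ ball (0 : E n) 1 := by
        rw [mem_ball_zero_iff]; exact hx1.2.trans_le (hd i)
      have hgx : 0 < g ‖x‖ := hx.2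
      refine ⟨?_, hxb⟩
      rw [Function.mem_support, stepFun_of_mem hdis _ hx1]
      have := hpos x (ball_subset_closedBall hxb)
      positivity
  have hgrad : ∫ x in ball (0 : E n) 1, ‖grad η x‖ ^ 2
      = (lam + σ) * (Q - avg V (fn φ) * P) := by
    have h1 := hφ.weak ζ
    have h2 : ∫ x in ball (0 : E n) 1, ‖grad η x‖ ^ 2
        = ∫ x in ball (0 : E n) 1, ⟪grad φ x, grad ζ x⟫_ℝ := by
      refine integral_congr_ae ?_
      filter_upwards [hp.grad_eq, hη2, hζ2, ae_ne_zero hn1] with x e1 e2 e3 e4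
      rw [e1, e2, e3, inner_radField _ _ e4, norm_radField _ e4, stepFun_sq hdis, Real.norm_eq_abs,
        sq_abs]
      ring
    have i1 : Integrable (fun x => V x * fn ζ x * g ‖x‖) (ballMeasure n) := by
      have hgm : MemLp (fun x : E n => g ‖x‖) 2 (ballMeasure n) :=
        memLp_ball_of_continuous (hp.continuous.comp continuous_norm).continuousOn 2
      refine (integrable_V_mul hV ((memLp_fn ζ).integrable_mul hgm)).congr (.of_forall fun x => ?_)
      simp only [Pi.mul_apply]; ring
    have i2 : Integrable (fun x => avg V (fn φ) * (V x * fn ζ x)) (ballMeasure n) :=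
      (integrable_V_mul hV (integrable_fn ζ)).const_mul _
    rw [h2, h1, hQ', hPdef, ← integral_const_mul (avg V (fn φ)) fun x => V x * fn ζ x,
      ← integral_sub i1 i2]
    congr 1
    refine integral_congr_ae ?_
    filter_upwards [hp.fn_eq] with x e1
    rw [osc, e1]
    ring
  -- Nonnegativity of the Dirichlet integral gives `Q ≥ a P > 0`, so the quotient is well defined
  -- and `η` is nonzero.
  have hQpos : 0 < Q := by
    have h1 : 0 ≤ ∫ x in ball (0 : E n) 1, ‖grad η x‖ ^ 2 :=
      integral_nonneg fun x => sq_nonneg _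
    rw [hgrad] at h1
    have h2 := nonneg_of_mul_nonneg_right h1 hm
    have h3 := mul_pos ha hP
    linarith
  -- The quotient equals `σ - (λ + σ) a P / Q`.
  have hray : rayleigh V lam η < σ := by
    rw [rayleigh, ← hQ, hgrad, div_lt_iff₀ hQpos]
    nlinarith [mul_pos hm (mul_pos ha hP)]
  have hadm : η ∈ admissible V X e k := by
    refine ⟨hX ⟨fun r => g r * stepFun c d t r, hη1⟩, ?_, ?_⟩
    · rintro rfl
      refine hQpos.ne' ?_
      rw [hQ, oscForm, hosc]
      refine integral_eq_zero_of_ae ?_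
      have h0 : fn (0 : H10 n) =ᵐ[ballMeasure n] 0 := Lp.coeFn_zero ℝ 2 (ballMeasure n)
      filter_upwards [h0] with x hx
      simp [hx]
    · intro i hi1 hi2
      have := horth ⟨i, hi2⟩
      simp only [w, show i ≠ 0 by omega, if_false] at this
      rw [oscForm, hosc, ← this]
      congr 1; ext x; ring
  have hmin : rayleigh V lam (e k) ≤ rayleigh V lam η := (he k hk le_rfl).2 hadm
  rw [← hσe] at hmin
  exact absurd hray (not_lt.2 hmin)

end Courant

/-! ### Geometry of generalized nodal domains. -/

section

variable {n : ℕ} {V : E n → ℝ} {m a : ℝ} {φ : H10 n} {g g₁ g₂ : ℝ → ℝ}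

lemma IsProfile.profileDeriv_eq (hp : IsProfile V m a φ g g₁ g₂) {r : ℝ} (hr : r ∈ Icc (0 : ℝ) 1) :
    profileDeriv g r = g₁ r :=
  (hp.deriv_one r).hasDerivWithinAt.derivWithin (uniqueDiffOn_Icc one_pos r hr)

lemma eventually_smul_mem {U : Set (E n)} (hU : IsOpen U) {r : ℝ} {u : E n} (h : r • u ∈ U) :
    ∀ᶠ s in nhds r, s • u ∈ U :=
  (continuous_id.smul continuous_const : Continuous fun s : ℝ => s • u).continuousAt.eventually
    (hU.mem_nhds h)

/-- An interior zero of a function with a sign is an extremum along its ray; at the origin the slope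
always vanishes. -/
lemma deriv_eq_zero_of_sign (hp : IsProfile V m a φ g g₁ g₂) {U : Set (E n)} (hU : IsOpen U)
    (hs : (∀ x ∈ U, 0 ≤ g ‖x‖) ∨ ∀ x ∈ U, g ‖x‖ ≤ 0) {y : E n} (hy : y ∈ U) (h0 : g ‖y‖ = 0) :
    g₁ ‖y‖ = 0 := by
  by_cases hy0 : y = 0
  · rw [hy0, norm_zero]; exact hp.deriv_zero
  have hr : 0 < ‖y‖ := norm_pos_iff.2 hy0
  have h1 : ∀ᶠ s in nhds ‖y‖, s • (‖y‖⁻¹ • y) ∈ U :=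
    eventually_smul_mem hU (by rwa [smul_smul, mul_inv_cancel₀ hr.ne', one_smul])
  have h2 : ∀ᶠ s in nhds ‖y‖, ‖s • (‖y‖⁻¹ • y)‖ = s := by
    filter_upwards [lt_mem_nhds hr] with s hs
    rw [norm_smul, norm_smul, norm_inv, norm_norm, inv_mul_cancel₀ hr.ne', mul_one,
      Real.norm_eq_abs, abs_of_pos hs]
  rcases hs with hs | hs
  · have : IsLocalMin g ‖y‖ := by
      filter_upwards [h1, h2] with s h3 h4
      have := hs _ h3
      rwa [h4, ← h0] at this
    exact this.hasDerivAt_eq_zero (hp.deriv_one _)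
  · have : IsLocalMax g ‖y‖ := by
      filter_upwards [h1, h2] with s h3 h4
      have := hs _ h3
      rwa [h4, ← h0] at this
    exact this.hasDerivAt_eq_zero (hp.deriv_one _)

/-- A boundary point of `Ω'` inside `Ω` would be a zero with vanishing slope, which the regularity
condition on `∂Ω'` excludes. So `Ω` misses `∂Ω'`, and connectedness finishes. Distinct domains are
therefore disjoint. -/
lemma IsGeneralizedNodalDomain.subset_of_inter (hp : IsProfile V m a φ g g₁ g₂)
    {Ω Ω' : Set (E n)} (h : IsGeneralizedNodalDomain g Ω) (h' : IsGeneralizedNodalDomain g Ω')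
    (hne : (Ω ∩ Ω').Nonempty) : Ω ⊆ Ω' := by
  by_cases hf : (Ω ∩ frontier Ω').Nonempty
  · obtain ⟨y, hy, hy'⟩ := hf
    have hy1 : ‖y‖ < 1 := by simpa using h.subset_ball hy
    have h0 := h'.frontier_zero y hy'
    have h1 := h'.frontier_regular y hy' hy1
    rw [hp.profileDeriv_eq ⟨norm_nonneg _, hy1.le⟩] at h1
    exact absurd (deriv_eq_zero_of_sign hp h.isOpen h.sign hy h0) h1
  · refine h.isConnected.isPreconnected.subset_left_of_subset_union h'.isOpen
      isClosed_closure.isOpen_compl (v := (closure Ω')ᶜ) ?_ ?_ hne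
    · exact disjoint_compl_right.mono_left subset_closure
    · intro x hx
      by_cases hx' : x ∈ closure Ω'
      · left
        by_contra hx''
        exact hf ⟨x, hx, hx', by rwa [h'.isOpen.interior_eq]⟩
      · exact .inr hx'

lemma IsGeneralizedNodalDomain.eq_of_inter (hp : IsProfile V m a φ g g₁ g₂)
    {Ω Ω' : Set (E n)} (h : IsGeneralizedNodalDomain g Ω) (h' : IsGeneralizedNodalDomain g Ω')
    (hne : (Ω ∩ Ω').Nonempty) : Ω = Ω' :=
  (h.subset_of_inter hp h' hne).antisymm (h'.subset_of_inter hp h (inter_comm Ω Ω' ▸ hne))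

/-- `Ω` fills the annulus `c < |x| < d`, whose boundary spheres are zeros of the profile. -/
structure IsAnnulus (g : ℝ → ℝ) (Ω : Set (E n)) (c d : ℝ) : Prop where
  nonneg : 0 ≤ c
  lt : c < d
  le_one : d ≤ 1
  mem : ∀ x : E n, ‖x‖ ∈ Ioo c d → x ∈ Ω
  right_zero : g d = 0
  left_zero : c = 0 ∨ g c = 0
  right_regular : d < 1 → profileDeriv g d ≠ 0

lemma exists_unit (hn : 1 ≤ n) : ∃ u : E n, ‖u‖ = 1 := by
  have : Nonempty (Fin n) := ⟨⟨0, hn⟩⟩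
  exact exists_norm_eq (E n) zero_le_one

/-- The norms of points of `Ω` form an interval, and radial symmetry fills in the spheres. Openness
prevents the supremum, and a positive infimum, from being attained, so those end spheres lie in the
frontier. -/
lemma IsGeneralizedNodalDomain.exists_annulus (hn : 1 ≤ n) {Ω : Set (E n)}
    (h : IsGeneralizedNodalDomain g Ω) : ∃ c d, IsAnnulus g Ω c d := by
  have : Nonempty (Fin n) := ⟨⟨0, hn⟩⟩
  obtain ⟨u, hu⟩ := exists_unit hn
  set I : Set ℝ := norm '' Ω with hI
  have hIc : IsConnected I := h.isConnected.image _ continuous_norm.continuousOn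
  have hI0 : ∀ r ∈ I, 0 ≤ r := by rintro _ ⟨x, -, rfl⟩; exact norm_nonneg x
  have hI1 : ∀ r ∈ I, r < 1 := by rintro _ ⟨x, hx, rfl⟩; simpa using h.subset_ball hx
  have hbb : BddBelow I := ⟨0, hI0⟩
  have hba : BddAbove I := ⟨1, fun r hr => (hI1 r hr).le⟩
  set c := sInf I
  set d := sSup I
  have hc0 : 0 ≤ c := le_csInf hIc.nonempty hI0
  have hd1 : d ≤ 1 := csSup_le hIc.nonempty fun r hr => (hI1 r hr).le
  have hIoo : Ioo c d ⊆ I := hIc.Ioo_csInf_csSup_subset hbb hba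
  have hmem : ∀ x : E n, ‖x‖ ∈ Ioo c d → x ∈ Ω := by
    intro x hx
    obtain ⟨y, hy, hyx⟩ := hIoo hx
    exact h.radial y x hyx hy
  -- Otherwise the nonempty open set `Ω` would lie in a sphere, which is a null set.
  have hcd : c < d := by
    refine lt_of_le_of_ne (csInf_le_csSup hIc.nonempty hbb hba) fun hcd => ?_
    have hsub : Ω ⊆ sphere (0 : E n) c := by
      intro x hx
      have hxI : ‖x‖ ∈ I := mem_image_of_mem _ hx
      rw [mem_sphere_zero_iff_norm]
      exact le_antisymm ((le_csSup hba hxI).trans_eq hcd.symm) (csInf_le hbb hxI)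
    have h1 := h.isOpen.measure_pos volume h.isConnected.nonempty
    have h2 := (measure_mono (μ := volume) hsub).trans_eq (Measure.addHaar_sphere volume 0 c)
    exact absurd h1 (not_lt.2 h2)
  have hnorm : ∀ s : ℝ, 0 ≤ s → ‖s • u‖ = s := by
    intro s hs
    rw [norm_smul, hu, mul_one, Real.norm_eq_abs, abs_of_nonneg hs]
  have hcl : ∀ r ∈ Icc c d, r • u ∈ closure Ω := by
    intro r hr
    rw [← closure_Ioo hcd.ne] at hr
    have hcont : Continuous fun s : ℝ => s • u := continuous_id.smul continuous_const
    refine map_mem_closure (f := fun s : ℝ => s • u) hcont hr fun s hs => hmem _ ?_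
    rwa [hnorm s (hc0.trans hs.1.le)]
  have hdf : d • u ∈ frontier Ω := by
    refine ⟨hcl d ⟨hcd.le, le_rfl⟩, ?_⟩
    rw [h.isOpen.interior_eq]
    intro hd
    obtain ⟨s, hs, hs'⟩ := ((eventually_smul_mem h.isOpen hd).filter_mono
      nhdsWithin_le_nhds |>.and (self_mem_nhdsWithin (s := Ioi d))).exists
    have hs2 : d < s := hs'
    have : s ∈ I := ⟨_, hs, hnorm s (by linarith)⟩
    exact absurd (le_csSup hba this) (not_le.2 hs')
  have hd0 : ‖d • u‖ = d := hnorm d (hc0.trans hcd.le)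
  refine ⟨c, d, hc0, hcd, hd1, hmem, ?_, ?_, ?_⟩
  · have := h.frontier_zero _ hdf
    rwa [hd0] at this
  · rcases eq_or_lt_of_le hc0 with hc | hc
    · exact .inl hc.symm
    · right
      have hcf : c • u ∈ frontier Ω := by
        refine ⟨hcl c ⟨le_rfl, hcd.le⟩, ?_⟩
        rw [h.isOpen.interior_eq]
        intro hcm
        obtain ⟨s, ⟨hs, hs0⟩, hs'⟩ := (((eventually_smul_mem h.isOpen hcm).and
          (lt_mem_nhds hc)).filter_mono nhdsWithin_le_nhds |>.and
            (self_mem_nhdsWithin (s := Iio c))).exists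
        have : s ∈ I := ⟨_, hs, hnorm s hs0.le⟩
        exact absurd (csInf_le hbb this) (not_le.2 hs')
      have := h.frontier_zero _ hcf
      rwa [hnorm c hc0] at this
  · intro hd
    have := h.frontier_regular _ hdf (by rwa [hd0])
    rwa [hd0] at this

lemma IsAnnulus.separated (hn : 1 ≤ n) {Ω Ω' : Set (E n)} {c d c' d' : ℝ}
    (h : IsAnnulus g Ω c d) (h' : IsAnnulus g Ω' c' d') (hdis : ¬ (Ω ∩ Ω').Nonempty) :
    d ≤ c' ∨ d' ≤ c := by
  by_contra hcon
  push Not at hcon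
  obtain ⟨u, hu⟩ := exists_unit hn
  obtain ⟨r, h1, h2⟩ := exists_between (max_lt (lt_min h.lt hcon.2) (lt_min hcon.1 h'.lt) :
    max c c' < min d d')
  rw [max_lt_iff] at h1
  rw [lt_min_iff] at h2
  have hr : ‖r • u‖ = r := by
    rw [norm_smul, hu, mul_one, Real.norm_eq_abs, abs_of_pos (h.nonneg.trans_lt h1.1)]
  exact hdis ⟨r • u, h.mem _ (by rw [hr]; exact ⟨h1.1, h2.1⟩),
    h'.mem _ (by rw [hr]; exact ⟨h1.2, h2.2⟩)⟩

lemma exists_injective_of_lt_encard {α : Type*} {s : Set α} {k : ℕ} (h : (k : ℕ∞) < s.encard) :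
    ∃ f : Fin (k + 1) → α, Function.Injective f ∧ ∀ i, f i ∈ s := by
  obtain ⟨t, hts, ht⟩ := exists_subset_encard_eq (Order.add_one_le_of_lt h)
  have hfin : t.Finite := finite_of_encard_eq_coe (k := k + 1) (by rw [ht]; rfl)
  have hcard : hfin.toFinset.card = k + 1 := by
    have := hfin.encard_eq_coe_toFinset_card
    rw [ht] at this
    exact_mod_cast this.symm
  let e := (hfin.toFinset.equivFinOfCardEq hcard).symm
  refine ⟨fun i => e i, Subtype.val_injective.comp e.injective, fun i => hts ?_⟩
  exact hfin.mem_toFinset.1 (e i).2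

lemma eventually_pos_right {g : ℝ → ℝ} {g' d : ℝ} (hg : HasDerivAt g g' d) (h0 : g d = 0)
    (hpos : 0 < g') : ∀ᶠ s in nhdsWithin d (Ioi d), 0 < g s := by
  have h1 : ∀ᶠ s in nhdsWithin d {d}ᶜ, 0 < slope g d s :=
    (hasDerivAt_iff_tendsto_slope.1 hg).eventually (lt_mem_nhds hpos)
  have h2 := h1.filter_mono (nhdsWithin_mono d fun s (hs : d < s) => hs.ne')
  filter_upwards [h2, self_mem_nhdsWithin] with s h3 h4
  rw [slope_def_field, h0, sub_zero] at h3
  exact (div_pos_iff_of_pos_right (sub_pos.2 h4)).1 h3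

lemma eventually_pos_left {g : ℝ → ℝ} {g' d : ℝ} (hg : HasDerivAt g g' d) (h0 : g d = 0)
    (hneg : g' < 0) : ∀ᶠ s in nhdsWithin d (Iio d), 0 < g s := by
  have h1 : ∀ᶠ s in nhdsWithin d {d}ᶜ, slope g d s < 0 :=
    (hasDerivAt_iff_tendsto_slope.1 hg).eventually (gt_mem_nhds hneg)
  have h2 := h1.filter_mono (nhdsWithin_mono d fun s (hs : s < d) => hs.ne)
  filter_upwards [h2, self_mem_nhdsWithin] with s h3 h4
  rw [slope_def_field, h0, sub_zero] at h3
  by_contra hcon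
  exact absurd h3 (not_lt.2 (div_nonneg_of_nonpos (not_lt.1 hcon) (sub_neg.2 h4).le))

/-- A function that becomes positive to the right of `d` stays so up to its next zero. -/
lemma exists_next_zero {g : ℝ → ℝ} (hg : Continuous g) {d b : ℝ} (hdb : d < b) (hb : g b = 0)
    (hpos : ∀ᶠ s in nhdsWithin d (Ioi d), 0 < g s) :
    ∃ d', d < d' ∧ d' ≤ b ∧ g d' = 0 ∧ (∀ s ∈ Ioo d d', 0 < g s) ∧
      ∀ z, d < z → z ≤ b → g z = 0 → d' ≤ z := by
  obtain ⟨p, hp, hp'⟩ := (mem_nhdsGT_iff_exists_Ioo_subset).1 hpos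
  have hdp : d < p := hp
  have hz : ∀ z, d < z → g z = 0 → p ≤ z := by
    intro z h1 h2
    by_contra hcon
    have : 0 < g z := hp' ⟨h1, not_le.1 hcon⟩
    linarith
  -- Positivity near `d` pushes the later zeros into `[p, b]`, so they form a compact set and there
  -- is a first one.
  have hcomp : IsCompact (Icc p b ∩ g ⁻¹' {0}) :=
    isCompact_Icc.inter_right (isClosed_singleton.preimage hg)
  obtain ⟨d', ⟨⟨h1, h2⟩, h3⟩, h4⟩ := hcomp.exists_isLeast ⟨b, ⟨hz b hdb hb, le_rfl⟩, hb⟩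
  have hleast : ∀ z, d < z → z ≤ b → g z = 0 → d' ≤ z := fun z hz1 hz2 hz3 =>
    h4 ⟨⟨hz z hz1 hz3, hz2⟩, hz3⟩
  refine ⟨d', hdp.trans_le h1, h2, h3, fun s hs => ?_, hleast⟩
  by_contra hcon
  have hsp : p ≤ s := by
    by_contra hlt
    exact hcon (hp' ⟨hs.1, not_le.1 hlt⟩)
  obtain ⟨q, hq1, hq2⟩ := exists_between hdp
  have hgq : 0 < g q := hp' ⟨hq1, hq2⟩
  obtain ⟨z, hz1, hz2⟩ := intermediate_value_Icc' (hq2.le.trans hsp) hg.continuousOn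
    (show (0 : ℝ) ∈ Icc (g s) (g q) from ⟨not_lt.1 hcon, hgq.le⟩)
  have := hleast z (hq1.trans_le hz1.1) (hz1.2.trans (hs.2.le.trans h2)) hz2
  linarith [hs.2, hz1.2]

end

/-! ### Counting nonnegative and negative domains. -/

section Count

variable {n : ℕ} {V : E n → ℝ} {lam σ : ℝ} {φ : H10 n} {g g₁ g₂ : ℝ → ℝ}

lemma encard_nonneg_le (hn : 2 ≤ n) (hV : ContinuousOn V (closedBall 0 1))
    (hpos : ∀ x ∈ closedBall (0 : E n) 1, 0 < V x) {X : Set (H10 n)} (hX : radialH10 n ⊆ X)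
    {k : ℕ} (hk : 1 ≤ k) (hσ : IsKthEigenvalue V lam X k σ) (hφ : IsEigenfunction V lam σ φ)
    (ha : 0 < avg V (fn φ)) (hp : IsProfile V (lam + σ) (avg V (fn φ)) φ g g₁ g₂) :
    {Ω : Set (E n) | IsGeneralizedNodalDomain g Ω ∧ ∀ x ∈ Ω, 0 ≤ g ‖x‖}.encard ≤ k := by
  have hn1 : 1 ≤ n := by omega
  by_contra hcon
  obtain ⟨Ω, hinj, hΩ⟩ := exists_injective_of_lt_encard (not_le.1 hcon)
  choose c d hcd using fun i => (hΩ i).1.exists_annulus hn1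
  obtain ⟨u, hu⟩ := exists_unit hn1
  have hnorm : ∀ i, ∀ r ∈ Ioo (c i) (d i), ‖r • u‖ = r ∧ r • u ∈ Ω i := by
    intro i r hr
    have : ‖r • u‖ = r := by
      rw [norm_smul, hu, mul_one, Real.norm_eq_abs, abs_of_pos ((hcd i).nonneg.trans_lt hr.1)]
    exact ⟨this, (hcd i).mem _ (by rwa [this])⟩
  refine courant hn hV hpos hX hk hσ hφ ha hp (c := c) (d := d) (fun i => (hcd i).nonneg)
    (fun i => (hcd i).lt) (fun i => (hcd i).le_one) (fun i j hij => ?_)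
    (fun i => (hcd i).right_zero) (fun i => (hcd i).left_zero) (fun i r hr => ?_) (fun i => ?_)
  · exact (hcd i).separated hn1 (hcd j) fun hne =>
      hij (hinj ((hΩ i).1.eq_of_inter hp (hΩ j).1 hne))
  · obtain ⟨h1, h2⟩ := hnorm i r hr
    have := (hΩ i).2 _ h2
    rwa [h1] at this
  · obtain ⟨S, -, hS⟩ := (hΩ i).1.nonneg (hΩ i).2
    -- The exceptional spheres are finitely many, so some radius in the interval carries a strictly
    -- positive value.
    obtain ⟨r, hr, hrS⟩ := (Ioo_infinite (hcd i).lt).exists_notMem_finset S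
    obtain ⟨h1, h2⟩ := hnorm i r hr
    have := hS _ h2 (by rwa [h1])
    rw [h1] at this
    exact ⟨r, hr, this⟩

/-- Supplies the positive bump just outside a negative domain, to which the Courant argument can be
applied in place of the domain itself. -/
lemma exists_positive_follower (hn : 1 ≤ n) {m a : ℝ} (hV : ContinuousOn V (closedBall 0 1))
    (hpos : ∀ x ∈ closedBall (0 : E n) 1, 0 < V x) (hm : 0 < m) (ha : 0 < a)
    (hp : IsProfile V m a φ g g₁ g₂) {Ω : Set (E n)} (h : IsGeneralizedNodalDomain g Ω)
    (hneg : ∀ x ∈ Ω, g ‖x‖ ≤ 0) :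
    ∃ c d d', IsAnnulus g Ω c d ∧ d < d' ∧ d' ≤ 1 ∧ g d' = 0 ∧ (∀ s ∈ Ioo d d', 0 < g s) ∧
      ∀ z, d < z → z ≤ 1 → g z = 0 → d' ≤ z := by
  obtain ⟨c, d, hcd⟩ := h.exists_annulus hn
  obtain ⟨u, hu⟩ := exists_unit hn
  have hd0 : 0 < d := hcd.nonneg.trans_lt hcd.lt
  have hgneg : ∀ᶠ s in nhdsWithin d (Iio d), g s < 0 := by
    filter_upwards [Ioo_mem_nhdsLT hcd.lt] with s hs
    have h1 : ‖s • u‖ = s := by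
      rw [norm_smul, hu, mul_one, Real.norm_eq_abs, abs_of_pos (hcd.nonneg.trans_lt hs.1)]
    have h2 := h.neg hneg _ (hcd.mem (s • u) (by rwa [h1]))
    rwa [h1] at h2
  -- At `r = 1` the profile has a double zero with positive second derivative, hence a local
  -- minimum, so it cannot be negative just inside the unit sphere.
  have hd1 : d < 1 := by
    refine lt_of_le_of_ne hcd.le_one ?_
    rintro rfl
    have hg₂ := hp.second_pos hn hV hpos hm ha (r := 1) (by simp) hp.one hp.deriv_at_one
    have e1 : deriv g = g₁ := funext fun r => (hp.deriv_one r).deriv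
    have hmin : IsLocalMin g 1 := by
      refine isLocalMin_of_deriv_deriv_pos ?_ ?_ hp.continuous.continuousAt
      · rw [e1, (hp.deriv_two 1).deriv]; exact hg₂
      · rw [e1]; exact hp.deriv_at_one
    obtain ⟨s, h1, h2⟩ := (hgneg.and (hmin.filter_mono nhdsWithin_le_nhds)).exists
    rw [hp.one] at h2
    linarith
  have hreg := hcd.right_regular hd1
  rw [hp.profileDeriv_eq ⟨hd0.le, hd1.le⟩] at hreg
  have hg1 : 0 < g₁ d := by
    by_contra hcon
    have hlt := lt_of_le_of_ne (not_lt.1 hcon) hreg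
    obtain ⟨s, h1, h2⟩ := (hgneg.and (eventually_pos_left (hp.deriv_one d) hcd.right_zero hlt)).exists
    linarith
  obtain ⟨d', h1, h2, h3, h4, h5⟩ := exists_next_zero hp.continuous hd1 hp.one
    (eventually_pos_right (hp.deriv_one d) hcd.right_zero hg1)
  exact ⟨c, d, d', hcd, h1, h2, h3, h4, h5⟩

lemma encard_nonpos_le (hn : 2 ≤ n) (hV : ContinuousOn V (closedBall 0 1))
    (hpos : ∀ x ∈ closedBall (0 : E n) 1, 0 < V x) {X : Set (H10 n)} (hX : radialH10 n ⊆ X)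
    {k : ℕ} (hk : 1 ≤ k) (hσ : IsKthEigenvalue V lam X k σ) (hφ : IsEigenfunction V lam σ φ)
    (ha : 0 < avg V (fn φ)) (hp : IsProfile V (lam + σ) (avg V (fn φ)) φ g g₁ g₂) :
    {Ω : Set (E n) | IsGeneralizedNodalDomain g Ω ∧ ∀ x ∈ Ω, g ‖x‖ ≤ 0}.encard ≤ k := by
  have hn1 : 1 ≤ n := by omega
  have hm := eigenvalue_pos hn hV hpos hφ
  by_contra hcon
  obtain ⟨Ω, hinj, hΩ⟩ := exists_injective_of_lt_encard (not_le.1 hcon)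
  choose c d d' hcd h1 h2 h3 h4 h5 using
    fun i => exists_positive_follower hn1 hV hpos hm ha hp (hΩ i).1 (hΩ i).2
  refine courant hn hV hpos hX hk hσ hφ ha hp (c := d) (d := d')
    (fun i => (hcd i).nonneg.trans (hcd i).lt.le) h1 h2 (fun i j hij => ?_) h3
    (fun i => .inr (hcd i).right_zero) (fun i r hr => (h4 i r hr).le) (fun i => ?_)
  -- If domain `j` lies beyond domain `i`, its outer radius is a zero past `d i`, so the follower of
  -- `i` ends before the follower of `j` begins.
  · rcases (hcd i).separated hn1 (hcd j) fun hne =>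
      hij (hinj ((hΩ i).1.eq_of_inter hp (hΩ j).1 hne)) with h | h
    · exact .inl (h5 i _ (h.trans_lt (hcd j).lt) (hcd j).le_one (hcd j).right_zero)
    · exact .inr (h5 j _ (h.trans_lt (hcd i).lt) (hcd i).le_one (hcd i).right_zero)
  · obtain ⟨r, hr⟩ := nonempty_Ioo.2 (h1 i)
    exact ⟨r, hr, h4 i r hr⟩

end Count

/-! ### Smoothness of the profile, continuity of the weight and conclusion. -/

lemma IsProfile.contDiff {n : ℕ} {V : E n → ℝ} {m a : ℝ} {φ : H10 n} {g g₁ g₂ : ℝ → ℝ}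
    (hp : IsProfile V m a φ g g₁ g₂) : ContDiff ℝ 2 g := by
  have e1 : deriv g = g₁ := funext fun r => (hp.deriv_one r).deriv
  have e2 : deriv g₁ = g₂ := funext fun r => (hp.deriv_two r).deriv
  rw [show (2 : ℕ∞ω) = 1 + 1 from rfl, contDiff_succ_iff_deriv]
  refine ⟨fun r => (hp.deriv_one r).differentiableAt, by simp, ?_⟩
  rw [e1, contDiff_one_iff_deriv, e2]
  exact ⟨fun r => (hp.deriv_two r).differentiableAt, hp.cont_two⟩

section Weight

variable {n : ℕ} {f : ℝ → ℝ} {lam α : ℝ} {ψ : E n → ℝ}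

lemma IsSolution.arg_pos (hψ : IsSolution f lam α ψ) (hlam : 0 ≤ lam) {x : E n}
    (hx : x ∈ closedBall (0 : E n) 1) : 0 < α + lam * ψ x := by
  have h0 : 0 ≤ ψ x := by
    rw [← ball_union_sphere] at hx
    rcases hx with hx | hx
    · exact (hψ.pos x hx).le
    · exact (hψ.boundary x hx).ge
  have := hψ.alpha_pos
  positivity

/-- The two-sided `deriv f` is controlled only on `(0, ∞)`. Since `α > 0`, the argument stays there
up to the boundary of the ball. -/
lemma IsSolution.continuousOn_weight (hψ : IsSolution f lam α ψ) (hlam : 0 ≤ lam)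
    (hf : ContDiffOn ℝ 2 f (Ici 0)) : ContinuousOn (weight f lam α ψ) (closedBall 0 1) := by
  have h1 : ContinuousOn (deriv f) (Ioi 0) :=
    (hf.mono Ioi_subset_Ici_self).continuousOn_deriv_of_isOpen isOpen_Ioi (by norm_num)
  refine h1.comp (g := deriv f) (f := fun x => α + lam * ψ x) ?_ fun x hx => hψ.arg_pos hlam hx
  exact continuousOn_const.add (continuousOn_const.mul hψ.contDiffOn.continuousOn)

end Weight

end MeanField

theorem mainTheorem2
    (n : ℕ) (hn : 2 ≤ n)
    (f : ℝ → ℝ) (hf : ContDiffOn ℝ 2 f (Set.Ici 0)) (hf_nonneg : ∀ t, 0 ≤ t → 0 ≤ f t)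
    (hf_deriv : ∀ t, 0 < t → 0 < deriv f t)
    (lam : ℝ) (hlam : 0 ≤ lam)
    (α : ℝ) (ψ : MeanField.E n → ℝ) (hψ : MeanField.IsSolution f lam α ψ)
    (k : ℕ) (hk : 1 ≤ k) (σ : ℝ)
    (hσ : MeanField.IsKthEigenvalue (MeanField.weight f lam α ψ) lam (MeanField.radialH10 n) k σ ∨
      MeanField.IsKthEigenvalue (MeanField.weight f lam α ψ) lam Set.univ k σ)
    (φ : MeanField.H10 n)
    (hφ : MeanField.IsEigenfunction (MeanField.weight f lam α ψ) lam σ φ)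
    (hφ_radial : φ ∈ MeanField.radialH10 n)
    (hφ_avg : 0 ≤ MeanField.avg (MeanField.weight f lam α ψ) (MeanField.fn φ)) :
    ∃ g : ℝ → ℝ, ContDiffOn ℝ 2 g (Set.Icc 0 1) ∧
      MeanField.fn φ =ᵐ[MeanField.ballMeasure n] (fun x => g ‖x‖) ∧
      {Ω₀ : Set (MeanField.E n) | MeanField.IsGeneralizedNodalDomain g Ω₀}.encard
        ≤ ((2 * k : ℕ) : ℕ∞) := by
  have hn1 : 1 ≤ n := by omega
  have hV := hψ.continuousOn_weight hlam hf
  have hpos : ∀ x ∈ Metric.closedBall (0 : MeanField.E n) 1, 0 < MeanField.weight f lam α ψ x :=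
    fun x hx => hf_deriv _ (hψ.arg_pos hlam hx)
  obtain ⟨g, g₁, g₂, hp⟩ := MeanField.exists_profile hn hV hpos hφ hφ_radial
  have ha : 0 < MeanField.avg (MeanField.weight f lam α ψ) (MeanField.fn φ) :=
    lt_of_le_of_ne hφ_avg (hp.avg_ne_zero hn1 hV hφ.1).symm
  -- Both enumerations are treated at once: the competitor is radial, so it only matters that the
  -- class contains the radial functions.
  obtain ⟨X, hX, hσX⟩ : ∃ X, MeanField.radialH10 n ⊆ X ∧
      MeanField.IsKthEigenvalue (MeanField.weight f lam α ψ) lam X k σ := by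
    rcases hσ with h | h
    · exact ⟨_, subset_rfl, h⟩
    · exact ⟨_, Set.subset_univ _, h⟩
  refine ⟨g, hp.contDiff.contDiffOn, hp.fn_eq, ?_⟩
  have hsub : {Ω₀ : Set (MeanField.E n) | MeanField.IsGeneralizedNodalDomain g Ω₀} ⊆
      {Ω | MeanField.IsGeneralizedNodalDomain g Ω ∧ ∀ x ∈ Ω, 0 ≤ g ‖x‖} ∪
      {Ω | MeanField.IsGeneralizedNodalDomain g Ω ∧ ∀ x ∈ Ω, g ‖x‖ ≤ 0} := by
    intro Ω hΩ
    rcases hΩ.sign with h | h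
    · exact .inl ⟨hΩ, h⟩
    · exact .inr ⟨hΩ, h⟩
  refine (Set.encard_le_encard hsub).trans ((Set.encard_union_le _ _).trans ?_)
  refine (add_le_add (MeanField.encard_nonneg_le hn hV hpos hX hk hσX hφ ha hp)
    (MeanField.encard_nonpos_le hn hV hpos hX hk hσX hφ ha hp)).trans_eq ?_
  push_cast
  ring
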